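/- Let $f\in C^\infty(\mathbb R)$ satisfy $f''\ge\sigma>0$ on $\mathbb R$, and let $S^1=\mathbb R/\mathbb Z$. For $0<\nu\le 1$ let $u=u(t,x)$ be a smooth solution on $[0,\infty)\times S^1$ of $$u_t+\big(f(u)\big)_x-\nu u_{xx}=0$$ with real-valued $C^\infty$ initial condition $u_0=u(0,\cdot)\not\equiv0$, $\int_{S^1}u_0\,dx=0$. For integers $m\ge0$ and $p\in[1,\infty]$ put $|v|_{m,p}=\big|\tfrac{d^mv}{dx^m}\big|_{L_p(S^1)}$, $\gamma=\gamma(m,p)=\max(0,m-1/p)$ (with $1/\infty=0$), and let $$D=\max\big(|u_0|_{0,1}^{-1},\,|u_0|_{1,\infty}\big).$$ There is a constant $\tilde C>0$, depending only on $f$ and $D$, such that $|u(t)|_{1,2}^2\le\tilde C\nu^{-1}$ for all $t\ge0$, all $\nu\in(0,1]$ and all such solutions $u$. Fix any such $\tilde C$, set $$T_1=\tfrac14D^{-2}\tilde C^{-1},\qquad T_2=\max\big(\tfrac32T_1,\ 2D\sigma^{-1}\big),\qquad \{A\}=\frac1{T_2-T_1}\int_{T_1}^{T_2}A(t)\,dt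 .$$ In what follows $C>0$ and $c>0$ denote constants that depend only on $f$, $\sigma$, $D$, $\tilde C$, $m$, $p$ and, in 1 and 3, on $\alpha$ (in 2 they do not depend on $\tilde C$); they do not depend on $\nu\in(0,1]$ nor, otherwise than through $D$, on $u_0$. 1. If $m\in\{0,1\}$ and $p\in[1,\infty]$, or $m\ge2$ and $p\in(1,\infty]$, then for every $\alpha>0$ $$C^{-1}\nu^{-\gamma}\le\big\{|u(t)|_{m,p}^{\alpha}\big\}^{1/\alpha}\le C\,\nu^{-\gamma}.$$ 2. For the same $m,p$, the upper estimate holds without time averaging, in the form $$|u(t)|_{m,p}\le C\max\big(t^{-\gamma},\nu^{-\gamma}\big)\qquad\text{for all }t>0.$$ 3. The lower estimate holds for all integers $m\ge0$, all $p\in[1,\infty]$ and all $\alpha>0$: $\ \big\{|u(t)|_{m,p}^{\alpha}\big\}^{1/\alpha}\ge c\,\nu^{-\gamma}$. -/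

import Mathlib

open scoped ENNReal ContDiff

noncomputable section

namespace Burgulence

/-- The (semi)norm `|v|_{m,p} = |d^m v / dx^m|_p` of a smooth function on the circle `ℝ/ℤ`. Functions
on the circle are represented by `1`-periodic functions on `ℝ`, and the `L_p` norm is taken over one
period; for `p = ∞` it is the essential supremum. -/
def sobolevNorm (m : ℕ) (p : ℝ≥0∞) (v : ℝ → ℝ) : ℝ :=
  (MeasureTheory.eLpNorm (iteratedDeriv m v) p
    (MeasureTheory.volume.restrict (Set.Ioc (0 : ℝ) 1))).toReal

/-- `u` is a smooth solution on `[0, ∞) × ℝ/ℤ` of `u_t + (f(u))_x - ν u_xx = 0` whose initial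
condition `u 0` has zero space average and is not identically zero. The values of `u t` for
`t < 0` are irrelevant. -/
structure IsSolution (f : ℝ → ℝ) (ν : ℝ) (u : ℝ → ℝ → ℝ) : Prop where
  smooth : ContDiffOn ℝ ∞ (fun z : ℝ × ℝ => u z.1 z.2) (Set.Ici (0 : ℝ) ×ˢ Set.univ)
  periodic : ∀ t, 0 ≤ t → Function.Periodic (u t) 1
  equation : ∀ t, 0 < t → ∀ x,
    deriv (fun s => u s x) t + deriv (fun y => f (u t y)) x - ν * iteratedDeriv 2 (u t) x = 0
  zero_mean : ∫ x in (0 : ℝ)..1, u 0 x = 0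
  nontrivial : ∃ x, u 0 x ≠ 0

/-- The quantity `D = max (|u₀|_1⁻¹, |u₀|_{1,∞})` of an initial condition. -/
def dataSize (u₀ : ℝ → ℝ) : ℝ :=
  max (sobolevNorm 0 1 u₀)⁻¹ (sobolevNorm 1 ∞ u₀)

/-- The exponent `γ(m, p) = max (0, m - 1/p)`, with `1/∞ = 0`. -/
def gammaExp (m : ℕ) (p : ℝ≥0∞) : ℝ := max 0 ((m : ℝ) - p⁻¹.toReal)

/-- `K` is a constant, depending on the initial condition only through `D` and not depending on the
viscosity `ν ∈ (0, 1]`, such that `‖u(t)‖_1^2 ≤ K ν⁻¹` for all `t ≥ 0`. -/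
def IsEnergyConst (f : ℝ → ℝ) (D K : ℝ) : Prop :=
  0 < K ∧ ∀ (ν : ℝ) (u : ℝ → ℝ → ℝ), 0 < ν → ν ≤ 1 → IsSolution f ν u → dataSize (u 0) = D →
    ∀ t, 0 ≤ t → sobolevNorm 1 2 (u t) ^ 2 ≤ K * ν⁻¹

/-- The left end `T₁` of the averaging interval. -/
def timeOne (D K : ℝ) : ℝ := 1 / 4 * (D ^ 2)⁻¹ * K⁻¹

/-- The right end `T₂` of the averaging interval. -/
def timeTwo (σ D K : ℝ) : ℝ := max (3 / 2 * timeOne D K) (2 * D * σ⁻¹)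

/-- The time average over `[T₁, T₂]`. -/
def timeAverage (σ D K : ℝ) (A : ℝ → ℝ) : ℝ :=
  1 / (timeTwo σ D K - timeOne D K) * ∫ t in (timeOne D K)..(timeTwo σ D K), A t

end Burgulence

end

/-!
# Sharp estimates for Sobolev norms in the decaying Burgers equation

**Upper estimates.** Only a priori estimates for a given smooth solution are needed, and the source of
all of them is the maximum principle on the circle (`maximum_principle`). It gives `u_x ≤ D` and
Oleinik's bound `u_x ≤ 1 / (σ t)`; since `u` has zero mean and is periodic, these control `|u|_∞` and
`|u_x|_1`. Applied to `-u_x - k (2 D ^ 2 - u ^ 2)` with `k` of order `ν⁻¹`, it gives `|u_x| ≤ M / ν`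
(`Admissible.abs_deriv_le`), hence the constant `K` of the energy estimate. Higher derivatives follow by
induction with Bernstein's method (`Admissible.bernstein`): on a time window of length comparable to
`μ = min(t, ν)`, the `m`-th derivative is at most of order `μ⁻ᵐ`
(`exists_abs_iteratedDeriv_le_scale`). For `1 < p < ∞` this is combined with the bound for `|u_x|_1`: on
each interval of length `μ`, interpolation bounds `|u⁽ᵐ⁾| ^ p` by `μ ^ (-m p)` times the variation of
`u` over that interval (`exists_abs_iteratedDeriv_rpow_le`), and integrating in `x` gains the factor `μ`
that turns the exponent `m` into `m - 1 / p` (`exists_sobolevNorm_le`).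

**Lower estimates.** The energy is at least `D⁻² / 2` at time `T₁`, and at most `D⁻² / 4` at time `T₂`
by Oleinik's bound, so that `ν ∫ |u_x|_2 ^ 2 dt` over `[T₁, T₂]` is bounded below
(`Admissible.integral_dissipation_ge`). As `ν |u_x|_2 ^ 2 ≤ K`, the dissipation rate `ν |u_x|_2 ^ 2` is
bounded below on a substantial set of times. At each such time `|u_x|_1 ≤ 2 D` forces `|u_x|_∞ ≥ c / ν`;
interpolation against `|u| ≤ D` gives `|u⁽ᵐ⁾|_∞ ≥ c ν⁻ᵐ`; and the upper bound for the derivative of order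
`m + 1` keeps `|u⁽ᵐ⁾|` of this size on an interval of length of order `ν`, which bounds all `L_p` norms
from below (`exists_sobolevNorm_ge_of_dissipation`). For `m = 0` the energy plays the role of the
dissipation rate.
-/

namespace Burgulence

open Set Filter Topology MeasureTheory

/-! ### Derivatives of functions of time and space -/

/-- The closed half plane of times `t ≥ 0`. -/
abbrev halfPlane : Set (ℝ × ℝ) := Ici (0 : ℝ) ×ˢ (univ : Set ℝ)

/-- The open half plane of times `t > 0`. -/
abbrev openHalfPlane : Set (ℝ × ℝ) := Ioi (0 : ℝ) ×ˢ (univ : Set ℝ)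

lemma isOpen_openHalfPlane : IsOpen openHalfPlane := isOpen_Ioi.prod isOpen_univ

lemma uniqueDiffOn_halfPlane : UniqueDiffOn ℝ halfPlane :=
  (uniqueDiffOn_Ici 0).prod uniqueDiffOn_univ

lemma periodic_iteratedDeriv {g : ℝ → ℝ} (hg : Function.Periodic g 1) (m : ℕ) :
    Function.Periodic (iteratedDeriv m g) 1 := by
  intro x
  have h := congrFun (iteratedDeriv_comp_add_const m g 1) x
  have hg' : (fun z => g (z + 1)) = g := funext hg
  rw [hg'] at h
  exact h.symm

lemma hasDerivAt_slice {V : ℝ × ℝ → ℝ} (hV : ContDiffOn ℝ ∞ V halfPlane) {t : ℝ} (ht : 0 ≤ t)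
    (x : ℝ) :
    HasDerivAt (fun y => V (t, y)) (fderivWithin ℝ V halfPlane (t, x) (0, 1)) x := by
  have h1 : HasFDerivWithinAt V (fderivWithin ℝ V halfPlane (t, x)) halfPlane (t, x) :=
    (hV.differentiableOn (by simp) (t, x) ⟨ht, mem_univ _⟩).hasFDerivWithinAt
  have h2 : HasDerivWithinAt (fun y : ℝ => (t, y)) ((0 : ℝ), (1 : ℝ)) univ x :=
    ((hasDerivAt_const x t).prodMk (hasDerivAt_id x)).hasDerivWithinAt
  have h3 := h1.comp_hasDerivWithinAt x h2 (fun y _ => ⟨ht, mem_univ _⟩)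
  simpa [hasDerivWithinAt_univ, Function.comp_def] using h3

/-- All spatial derivatives of a function that is smooth up to time `0` are jointly continuous up to
time `0`. -/
lemma continuousOn_iteratedDeriv_slice (m : ℕ) : ∀ {V : ℝ × ℝ → ℝ}, ContDiffOn ℝ ∞ V halfPlane →
    ContinuousOn (fun z : ℝ × ℝ => iteratedDeriv m (fun y => V (z.1, y)) z.2) halfPlane := by
  induction m with
  | zero =>
    intro V hV
    simpa using hV.continuousOn
  | succ m ih =>
    intro V hV
    have h1 : ContDiffOn ℝ ∞ (fun z => fderivWithin ℝ V halfPlane z (0, 1)) halfPlane :=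
      (hV.fderivWithin uniqueDiffOn_halfPlane (by simp)).clm_apply contDiffOn_const
    refine (ih h1).congr ?_
    rintro ⟨t, x⟩ ⟨ht, -⟩
    simp only [iteratedDeriv_succ']
    congr 1
    ext y
    exact (hasDerivAt_slice hV ht y).deriv

lemma contDiff_slice {V : ℝ × ℝ → ℝ} (hV : ContDiffOn ℝ ∞ V halfPlane) {t : ℝ} (ht : 0 ≤ t) :
    ContDiff ℝ ∞ (fun y => V (t, y)) := by
  rw [← contDiffOn_univ]
  exact hV.comp (by fun_prop) (fun y _ => ⟨ht, mem_univ _⟩)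

lemma hasDerivAt_slice_snd {V : ℝ × ℝ → ℝ} (hV : ContDiffOn ℝ ∞ V openHalfPlane) {t : ℝ}
    (ht : 0 < t) (x : ℝ) : HasDerivAt (fun y => V (t, y)) (fderiv ℝ V (t, x) (0, 1)) x := by
  have h1 : HasFDerivAt V (fderiv ℝ V (t, x)) (t, x) :=
    ((hV.contDiffAt (isOpen_openHalfPlane.mem_nhds (mk_mem_prod ht (mem_univ x)))).differentiableAt
      (by simp)).hasFDerivAt
  exact h1.comp_hasDerivAt x ((hasDerivAt_const x t).prodMk (hasDerivAt_id x))

lemma hasDerivAt_slice_fst {V : ℝ × ℝ → ℝ} (hV : ContDiffOn ℝ ∞ V openHalfPlane) {t : ℝ}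
    (ht : 0 < t) (x : ℝ) : HasDerivAt (fun s => V (s, x)) (fderiv ℝ V (t, x) (1, 0)) t := by
  have h1 : HasFDerivAt V (fderiv ℝ V (t, x)) (t, x) :=
    ((hV.contDiffAt (isOpen_openHalfPlane.mem_nhds (mk_mem_prod ht (mem_univ x)))).differentiableAt
      (by simp)).hasFDerivAt
  exact h1.comp_hasDerivAt t ((hasDerivAt_id t).prodMk (hasDerivAt_const t x))

/-- For positive times, the time derivative commutes with all spatial derivatives. -/
lemma hasDerivAt_iteratedDeriv_slice (m : ℕ) : ∀ {V : ℝ × ℝ → ℝ},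
    ContDiffOn ℝ ∞ V openHalfPlane → ∀ {t : ℝ}, 0 < t → ∀ x,
    HasDerivAt (fun s => iteratedDeriv m (fun y => V (s, y)) x)
      (iteratedDeriv m (fun y => deriv (fun s => V (s, y)) t) x) t := by
  induction m with
  | zero =>
    intro V hV t ht x
    simp only [iteratedDeriv_zero]
    exact (hasDerivAt_slice_fst hV ht x).differentiableAt.hasDerivAt
  | succ m ih =>
    intro V hV t ht x
    have hF : ContDiffOn ℝ ∞ (fderiv ℝ V) openHalfPlane :=
      hV.fderiv_of_isOpen isOpen_openHalfPlane (by simp)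
    have h1 : ContDiffOn ℝ ∞ (fun z => fderiv ℝ V z (0, 1)) openHalfPlane :=
      hF.clm_apply contDiffOn_const
    have h2 : ContDiffOn ℝ ∞ (fun z => fderiv ℝ V z (1, 0)) openHalfPlane :=
      hF.clm_apply contDiffOn_const
    have key := ih h1 ht x
    have hmixed : ∀ y, deriv (fun s => fderiv ℝ V (s, y) (0, 1)) t
        = deriv (fun y => deriv (fun s => V (s, y)) t) y := by
      intro y
      have hmem : openHalfPlane ∈ 𝓝 (t, y) := isOpen_openHalfPlane.mem_nhds ⟨ht, mem_univ _⟩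
      have hd : DifferentiableAt ℝ (fderiv ℝ V) (t, y) :=
        (hF.contDiffAt hmem).differentiableAt (by simp)
      have hsymm := ((hV.contDiffAt hmem).isSymmSndFDerivAt
        (by
          simpa using WithTop.coe_le_coe.2 (le_top : (2 : ℕ∞) ≤ ⊤))).eq (1, 0) (0, 1)
      have e1 : (fun y => deriv (fun s => V (s, y)) t) = fun y => fderiv ℝ V (t, y) (1, 0) := by
        ext y
        exact (hasDerivAt_slice_fst hV ht y).deriv
      rw [e1, (hasDerivAt_slice_fst h1 ht y).deriv, (hasDerivAt_slice_snd h2 ht y).deriv,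
        fderiv_clm_apply hd (by fun_prop), fderiv_clm_apply hd (by fun_prop)]
      simpa using hsymm
    simp only [hmixed] at key
    rw [iteratedDeriv_succ']
    refine key.congr_of_eventuallyEq ?_
    filter_upwards [lt_mem_nhds ht] with s hs
    rw [iteratedDeriv_succ']
    congr 1
    ext y
    exact (hasDerivAt_slice_snd hV hs y).deriv

/-! ### The equations satisfied by the spatial derivatives of a solution -/

lemma hasDerivAt_iteratedDeriv {g : ℝ → ℝ} (hg : ContDiff ℝ ∞ g) (m : ℕ) (x : ℝ) :
    HasDerivAt (iteratedDeriv m g) (iteratedDeriv (m + 1) g x) x := by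
  rw [iteratedDeriv_succ]
  exact ((hg.differentiable_iteratedDeriv m (by exact_mod_cast WithTop.coe_lt_top _)) x).hasDerivAt

lemma contDiff_iteratedDeriv {g : ℝ → ℝ} (hg : ContDiff ℝ ∞ g) (m : ℕ) :
    ContDiff ℝ ∞ (iteratedDeriv m g) := by
  rw [iteratedDeriv_eq_iterate]
  exact hg.iterate_deriv m

lemma continuous_iteratedDeriv {g : ℝ → ℝ} (hg : ContDiff ℝ ∞ g) (m : ℕ) :
    Continuous (iteratedDeriv m g) :=
  hg.continuous_iteratedDeriv m (by exact_mod_cast le_top)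

section Solution

variable {f : ℝ → ℝ} {ν : ℝ} {u : ℝ → ℝ → ℝ}

lemma IsSolution.contDiff (hu : IsSolution f ν u) {t : ℝ} (ht : 0 ≤ t) : ContDiff ℝ ∞ (u t) :=
  contDiff_slice hu.smooth ht

lemma IsSolution.continuousOn (hu : IsSolution f ν u) (m : ℕ) :
    ContinuousOn (fun z : ℝ × ℝ => iteratedDeriv m (u z.1) z.2) halfPlane :=
  continuousOn_iteratedDeriv_slice m hu.smooth

lemma IsSolution.periodic_iteratedDeriv (hu : IsSolution f ν u) {t : ℝ} (ht : 0 ≤ t) (m : ℕ) :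
    Function.Periodic (iteratedDeriv m (u t)) 1 :=
  Burgulence.periodic_iteratedDeriv (hu.periodic t ht) m

lemma IsSolution.hasDerivAt_space (hu : IsSolution f ν u) {t : ℝ} (ht : 0 ≤ t) (m : ℕ) (x : ℝ) :
    HasDerivAt (iteratedDeriv m (u t)) (iteratedDeriv (m + 1) (u t) x) x :=
  hasDerivAt_iteratedDeriv (hu.contDiff ht) m x

/-- The equation differentiated `m` times in space. -/
lemma IsSolution.hasDerivAt_time (hu : IsSolution f ν u) (hf : ContDiff ℝ ∞ f) {t : ℝ} (ht : 0 < t)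
    (m : ℕ) (x : ℝ) :
    HasDerivAt (fun s => iteratedDeriv m (u s) x)
      (ν * iteratedDeriv (m + 2) (u t) x - iteratedDeriv (m + 1) (f ∘ u t) x) t := by
  have hsub : openHalfPlane ⊆ halfPlane := prod_mono Ioi_subset_Ici_self subset_rfl
  have h := hasDerivAt_iteratedDeriv_slice m (hu.smooth.mono hsub) ht x
  have hut : ContDiff ℝ ∞ (u t) := hu.contDiff ht.le
  have hfu : ContDiff ℝ ∞ (f ∘ u t) := hf.comp hut
  have e : (fun y => deriv (fun s => u s y) t)
      = fun y => ν * iteratedDeriv 2 (u t) y - iteratedDeriv 1 (f ∘ u t) y := by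
    ext y
    have := hu.equation t ht y
    rw [iteratedDeriv_one]
    simp only [Function.comp_def]
    linarith
  have c2 : ContDiff ℝ ∞ (iteratedDeriv 2 (u t)) := contDiff_iteratedDeriv hut 2
  have c1 : ContDiff ℝ ∞ (iteratedDeriv 1 (f ∘ u t)) := contDiff_iteratedDeriv hfu 1
  convert h using 1
  simp only
  rw [e]
  have hle : ((m : ℕ) : WithTop ℕ∞) ≤ ((⊤ : ℕ∞) : WithTop ℕ∞) := by exact_mod_cast le_top
  rw [iteratedDeriv_fun_sub ((contDiff_const.mul c2).of_le hle).contDiffAt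
      (c1.of_le hle).contDiffAt, iteratedDeriv_const_mul ν (c2.of_le hle).contDiffAt]
  simp only [iteratedDeriv_eq_iterate, ← Function.iterate_add_apply]

end Solution

/-! ### A maximum principle on the circle -/

lemma deriv_eq_zero_and_second_deriv_nonpos {g g' : ℝ → ℝ} {c x : ℝ}
    (h1 : ∀ y, HasDerivAt g (g' y) y) (h2 : HasDerivAt g' c x) (hmax : ∀ y, g y ≤ g x) :
    g' x = 0 ∧ c ≤ 0 := by
  have hloc : IsLocalMax g x := Eventually.of_forall hmax
  have hz : g' x = 0 := hloc.hasDerivAt_eq_zero (h1 x)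
  refine ⟨hz, ?_⟩
  by_contra! hc
  have hg' : deriv g = g' := funext fun y => (h1 y).deriv
  have hmin : IsLocalMin g x := by
    apply isLocalMin_of_deriv_deriv_pos
    · rw [hg', h2.deriv]
      exact hc
    · rw [hg', hz]
    · exact (h1 x).continuousAt
  -- a local minimum that is a global maximum makes `g` locally constant, hence `c = 0`
  have hconst : ∀ᶠ y in 𝓝 x, g y = g x := by
    filter_upwards [hmin] with y hy using le_antisymm (hmax y) hy
  have hd : g' =ᶠ[𝓝 x] fun _ => 0 := by
    filter_upwards [hconst.eventually_nhds] with y hy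
    have : g =ᶠ[𝓝 y] fun _ => g x := hy
    rw [← hg', this.deriv_eq, deriv_const]
  have := hd.deriv_eq
  rw [h2.deriv, deriv_const] at this
  exact hc.ne' this

/-- A function on `[a, b] × ℝ/ℤ` that is nonpositive at time `a`, and whose time derivative is
negative at every positive spatial maximum, is nonpositive. -/
lemma maximum_principle {z : ℝ → ℝ → ℝ} {a b : ℝ}
    (hc : ContinuousOn (fun q : ℝ × ℝ => z q.1 q.2) (Icc a b ×ˢ univ))
    (hper : ∀ t ∈ Icc a b, Function.Periodic (z t) 1) (h0 : ∀ x, z a x ≤ 0)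
    (hstep : ∀ t ∈ Ioc a b, ∀ x, 0 < z t x → (∀ y, z t y ≤ z t x) →
      ∃ d < 0, HasDerivAt (fun s => z s x) d t) :
    ∀ t ∈ Icc a b, ∀ x, z t x ≤ 0 := by
  intro t ht x
  by_contra! hpos
  have hreduce : ∀ s ∈ Icc a b, ∀ y, ∃ y' ∈ Icc (0 : ℝ) 1, z s y = z s y' := by
    intro s hs y
    obtain ⟨y', hy', h⟩ := (hper s hs).exists_mem_Ico₀ one_pos y
    exact ⟨y', Ico_subset_Icc_self hy', h⟩
  obtain ⟨x', hx', hxx⟩ := hreduce t ht x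
  obtain ⟨⟨ts, xs⟩, ⟨hts, hxs⟩, hmax⟩ := (isCompact_Icc.prod isCompact_Icc).exists_isMaxOn
    ⟨(t, x'), ht, hx'⟩ (hc.mono (prod_mono subset_rfl (subset_univ (Icc (0 : ℝ) 1))))
  have hall : ∀ s ∈ Icc a b, ∀ y, z s y ≤ z ts xs := by
    intro s hs y
    obtain ⟨y', hy', h⟩ := hreduce s hs y
    rw [h]
    exact hmax (mk_mem_prod hs hy')
  have hp : 0 < z ts xs := hpos.trans_le (hall t ht x)
  have hne : a < ts := by
    rcases hts.1.eq_or_lt with h | h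
    · have h' : a = ts := h
      rw [← h'] at hp
      exact absurd (h0 xs) hp.not_ge
    · exact h
  obtain ⟨d, hd, hder⟩ := hstep ts ⟨hne, hts.2⟩ xs hp (hall ts hts)
  have hlim := (hasDerivWithinAt_iff_tendsto_slope' (by simp)).1
    (hder.hasDerivWithinAt (s := Iio ts))
  have : (0 : ℝ) ≤ d := by
    refine ge_of_tendsto hlim ?_
    filter_upwards [Ioo_mem_nhdsLT hne] with s hs
    rw [slope_def_field]
    exact div_nonneg_of_nonpos
      (sub_nonpos.2 (hall s ⟨hs.1.le, hs.2.le.trans hts.2⟩ xs)) (sub_nonpos.2 hs.2.le)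
  exact absurd hd this.not_gt

/-! ### Interpolation between derivatives on an interval -/

lemma abs_sub_le_of_hasDerivAt {g g' : ℝ → ℝ} {a b B : ℝ} (hg : ∀ y, HasDerivAt g (g' y) y)
    (hB : ∀ y ∈ Icc a b, |g' y| ≤ B) {x y : ℝ} (hx : x ∈ Icc a b) (hy : y ∈ Icc a b) :
    |g y - g x| ≤ B * |y - x| := by
  have := (convex_Icc a b).norm_image_sub_le_of_norm_hasDerivWithin_le (f := g) (f' := g')
    (fun z _ => (hg z).hasDerivWithinAt) (fun z hz => hB z hz) hx hy
  simpa [Real.norm_eq_abs] using this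

/-- A function bounded by `S` on an interval of length `h` has a `j`-th derivative of size at most
`C S h⁻ʲ` somewhere on that interval. -/
lemma exists_abs_iteratedDeriv_le (j : ℕ) : ∃ C : ℝ, 0 < C ∧ ∀ v : ℝ → ℝ, ContDiff ℝ ∞ v →
    ∀ x h S : ℝ, 0 < h → (∀ y ∈ Icc x (x + h), |v y| ≤ S) →
      ∃ ξ ∈ Icc x (x + h), |iteratedDeriv j v ξ| ≤ C * (S / h ^ j) := by
  induction j with
  | zero =>
    refine ⟨1, one_pos, fun v _ x h S hh hS => ⟨x, ⟨le_rfl, by linarith⟩, ?_⟩⟩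
    simpa using hS x ⟨le_rfl, by linarith⟩
  | succ j ih =>
    obtain ⟨C, hC, ih⟩ := ih
    refine ⟨2 * 3 ^ (j + 1) * C, by positivity, fun v hv x h S hh hS => ?_⟩
    -- the mean value theorem between points of the first and of the last third
    obtain ⟨ξ₁, h₁, e₁⟩ := ih v hv x (h / 3) S (by positivity)
      (fun y hy => hS y ⟨hy.1, by linarith [hy.2]⟩)
    obtain ⟨ξ₂, h₂, e₂⟩ := ih v hv (x + 2 * h / 3) (h / 3) S (by positivity)
      (fun y hy => hS y ⟨by linarith [hy.1], by linarith [hy.2]⟩)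
    have hlt : h / 3 ≤ ξ₂ - ξ₁ := by linarith [h₁.2, h₂.1]
    have hlt' : ξ₁ < ξ₂ := by linarith
    obtain ⟨ξ, hξ, e⟩ := exists_hasDerivAt_eq_slope (iteratedDeriv j v) (iteratedDeriv (j + 1) v)
      hlt' (continuous_iteratedDeriv hv j).continuousOn
      (fun y _ => hasDerivAt_iteratedDeriv hv j y)
    refine ⟨ξ, ⟨by linarith [h₁.1, hξ.1], by linarith [h₂.2, hξ.2]⟩, ?_⟩
    rw [e, abs_div, abs_of_pos (by linarith : (0 : ℝ) < ξ₂ - ξ₁), div_le_iff₀ (by linarith)]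
    have hS0 : 0 ≤ S := (abs_nonneg _).trans (hS x ⟨le_rfl, by linarith⟩)
    calc |iteratedDeriv j v ξ₂ - iteratedDeriv j v ξ₁|
        ≤ |iteratedDeriv j v ξ₂| + |iteratedDeriv j v ξ₁| := abs_sub _ _
      _ ≤ 2 * (C * (S / (h / 3) ^ j)) := by linarith
      _ = 2 * 3 ^ (j + 1) * C * (S / h ^ (j + 1)) * (h / 3) := by
          rw [div_pow]
          field_simp
          ring
      _ ≤ 2 * 3 ^ (j + 1) * C * (S / h ^ (j + 1)) * (ξ₂ - ξ₁) := by gcongr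

/-- Interpolation on an interval of length `h`. -/
lemma interpolation (k : ℕ) : ∀ j N : ℕ, N = j + k → ∃ C : ℝ, 0 < C ∧ ∀ v : ℝ → ℝ, ContDiff ℝ ∞ v →
    ∀ x h S T : ℝ, 0 < h → (∀ y ∈ Icc x (x + h), |v y| ≤ S) →
      (∀ y ∈ Icc x (x + h), |iteratedDeriv N v y| ≤ T) →
      ∀ y ∈ Icc x (x + h), |iteratedDeriv j v y| ≤ C * (S / h ^ j + h ^ k * T) := by
  induction k with
  | zero =>
    intro j N hN
    rw [add_zero] at hN
    subst hN
    refine ⟨1, one_pos, fun v hv x h S T hh hS hT y hy => ?_⟩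
    have hS0 : 0 ≤ S := (abs_nonneg _).trans (hS y hy)
    have := hT y hy
    have h2 : 0 ≤ S / h ^ N := by positivity
    simp only [pow_zero, one_mul]
    linarith
  | succ k ih =>
    intro j N hN
    obtain ⟨C, hC, ih⟩ := ih (j + 1) N (by omega)
    obtain ⟨C', hC', hξ⟩ := exists_abs_iteratedDeriv_le j
    refine ⟨C' + C, by positivity, fun v hv x h S T hh hS hT y hy => ?_⟩
    obtain ⟨ξ, hξm, hξ⟩ := hξ v hv x h S hh hS
    have h1 := ih v hv x h S T hh hS hT
    have h2 := abs_sub_le_of_hasDerivAt (hasDerivAt_iteratedDeriv hv j) h1 hξm hy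
    have hS0 : 0 ≤ S := (abs_nonneg _).trans (hS y hy)
    have hT0 : 0 ≤ T := (abs_nonneg _).trans (hT y hy)
    have h3 : |y - ξ| ≤ h := by
      rw [abs_le]
      constructor <;> linarith [hy.1, hy.2, hξm.1, hξm.2]
    have h4 : C * (S / h ^ (j + 1) + h ^ k * T) * |y - ξ|
        ≤ C * (S / h ^ (j + 1) + h ^ k * T) * h := by gcongr
    have h5 : C * (S / h ^ (j + 1) + h ^ k * T) * h = C * (S / h ^ j + h ^ (k + 1) * T) := by
      field_simp
      ring
    have h6 : |iteratedDeriv j v y| ≤ |iteratedDeriv j v ξ|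
        + |iteratedDeriv j v y - iteratedDeriv j v ξ| := by
      have := abs_add_le (iteratedDeriv j v ξ) (iteratedDeriv j v y - iteratedDeriv j v ξ)
      simpa using this
    have h7 : 0 ≤ C' * (h ^ (k + 1) * T) := by positivity
    nlinarith

/-! ### Integrals over one period -/

lemma integral_deriv_periodic {g g' : ℝ → ℝ} (hg : Function.Periodic g 1)
    (hd : ∀ x, HasDerivAt g (g' x) x) (hc : Continuous g') : ∫ x in (0 : ℝ)..1, g' x = 0 := by
  rw [intervalIntegral.integral_eq_sub_of_hasDerivAt (fun x _ => hd x)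
    (hc.intervalIntegrable _ _)]
  have := hg 0
  simp only [zero_add] at this
  rw [this, sub_self]

lemma continuous_comp_max {g : ℝ × ℝ → ℝ} (hg : ContinuousOn g halfPlane) :
    Continuous (fun z : ℝ × ℝ => g (max z.1 0, z.2)) := by
  rw [← continuousOn_univ]
  exact hg.comp (by fun_prop) (fun z _ => mk_mem_prod (le_max_right z.1 0) (mem_univ _))

lemma continuousOn_integral {g : ℝ × ℝ → ℝ} (hg : ContinuousOn g halfPlane) :
    ContinuousOn (fun t => ∫ x in (0 : ℝ)..1, g (t, x)) (Ici 0) := by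
  have h1 := intervalIntegral.continuous_parametric_intervalIntegral_of_continuous'
    (μ := volume) (f := fun t x => g (max t 0, x)) (continuous_comp_max hg) 0 1
  refine h1.continuousOn.congr fun t ht => ?_
  simp only [max_eq_left (mem_Ici.1 ht)]

lemma continuous_slice {g : ℝ × ℝ → ℝ} (hg : ContinuousOn g halfPlane) {t : ℝ} (ht : 0 ≤ t) :
    Continuous (fun x => g (t, x)) := by
  rw [← continuousOn_univ]
  exact hg.comp (by fun_prop) (fun y _ => ⟨ht, mem_univ _⟩)

/-- Differentiation in time under the integral over one period. -/
lemma hasDerivAt_integral {g g' : ℝ × ℝ → ℝ} (hg : ContinuousOn g halfPlane)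
    (hg' : ContinuousOn g' halfPlane)
    (hd : ∀ t, 0 < t → ∀ x, HasDerivAt (fun s => g (s, x)) (g' (t, x)) t) {t : ℝ} (ht : 0 < t) :
    HasDerivAt (fun s => ∫ x in (0 : ℝ)..1, g (s, x)) (∫ x in (0 : ℝ)..1, g' (t, x)) t := by
  have hsub : Icc (0 : ℝ) (2 * t) ×ˢ Icc (0 : ℝ) 1 ⊆ halfPlane :=
    prod_mono Icc_subset_Ici_self (subset_univ _)
  obtain ⟨B, hB⟩ := (isCompact_Icc.prod isCompact_Icc).exists_bound_of_continuousOn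
    (hg'.mono hsub)
  refine (intervalIntegral.hasDerivAt_integral_of_dominated_loc_of_deriv_le
    (F := fun s x => g (s, x)) (F' := fun s x => g' (s, x)) (bound := fun _ => B)
    (Ioo_mem_nhds ht (by linarith : t < 2 * t)) ?_ ?_ ?_ ?_ ?_ ?_).2
  · filter_upwards [lt_mem_nhds ht] with s hs
    exact (continuous_slice hg hs.le).aestronglyMeasurable
  · exact (continuous_slice hg ht.le).intervalIntegrable _ _
  · exact (continuous_slice hg' ht.le).aestronglyMeasurable
  · refine Eventually.of_forall fun x hx s hs => hB (s, x) ⟨Ioo_subset_Icc_self hs, ?_⟩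
    rw [uIoc_of_le zero_le_one] at hx
    exact Ioc_subset_Icc_self hx
  · exact intervalIntegrable_const
  · exact Eventually.of_forall fun x _ s hs => hd s hs.1 x

/-- A periodic function of zero mean whose derivative is bounded above is bounded. -/
lemma abs_le_of_deriv_le {v v' : ℝ → ℝ} {B : ℝ} (hper : Function.Periodic v 1)
    (hv : ∀ x, HasDerivAt v (v' x) x) (hmean : ∫ x in (0 : ℝ)..1, v x = 0) (hB : 0 ≤ B)
    (hle : ∀ x, v' x ≤ B) (x : ℝ) : |v x| ≤ B := by
  have hc : Continuous v := continuous_iff_continuousAt.2 fun x => (hv x).continuousAt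
  have hmv : ∀ y z, y ≤ z → z ≤ y + 1 → v z - v y ≤ B := by
    intro y z hyz hz
    have := image_sub_le_mul_sub_of_deriv_le (f := v) (fun x => (hv x).differentiableAt)
      (C := B) (fun x => by rw [(hv x).deriv]; exact hle x) hyz
    nlinarith
  have hshift : ∀ y, ∫ z in y..(y + 1), v z = 0 := by
    intro y
    rw [hper.intervalIntegral_add_eq y 0, zero_add, hmean]
  rw [abs_le]
  constructor
  · have h := intervalIntegral.integral_mono_on (by linarith : x ≤ x + 1)
      ((hc.intervalIntegrable (μ := volume) x (x + 1)).sub intervalIntegrable_const)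
      intervalIntegrable_const (fun z hz => hmv x z hz.1 hz.2)
    rw [intervalIntegral.integral_sub (hc.intervalIntegrable _ _) intervalIntegrable_const,
      hshift] at h
    simp only [intervalIntegral.integral_const, add_sub_cancel_left, one_smul] at h
    linarith
  · have h := intervalIntegral.integral_mono_on (by linarith : x - 1 ≤ x)
      (intervalIntegrable_const.sub (hc.intervalIntegrable (μ := volume) (x - 1) x))
      intervalIntegrable_const (fun z hz => hmv z x hz.2 (by linarith [hz.1]))
    have h0 := hshift (x - 1)
    rw [sub_add_cancel] at h0
    rw [intervalIntegral.integral_sub intervalIntegrable_const (hc.intervalIntegrable _ _),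
      h0] at h
    simp only [intervalIntegral.integral_const, sub_sub_cancel, one_smul] at h
    linarith

lemma integral_abs_deriv_le {v v' : ℝ → ℝ} {B : ℝ} (hper : Function.Periodic v 1)
    (hv : ∀ x, HasDerivAt v (v' x) x) (hc : Continuous v') (hB : 0 ≤ B)
    (hle : ∀ x, v' x ≤ B) : ∫ x in (0 : ℝ)..1, |v' x| ≤ 2 * B := by
  have h : ∀ x, |v' x| ≤ 2 * B - v' x := by
    intro x
    have := hle x
    rw [abs_le]
    constructor <;> linarith
  calc ∫ x in (0 : ℝ)..1, |v' x| ≤ ∫ x in (0 : ℝ)..1, (2 * B - v' x) :=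
        intervalIntegral.integral_mono_on zero_le_one (hc.abs.intervalIntegrable _ _)
          (intervalIntegrable_const.sub (hc.intervalIntegrable _ _)) (fun x _ => h x)
    _ = 2 * B := by
        rw [intervalIntegral.integral_sub intervalIntegrable_const (hc.intervalIntegrable _ _),
          integral_deriv_periodic hper hv hc]
        simp

/-! ### Bounds for the solution and its first derivative -/

/-- A solution of the Burgers equation with viscosity `ν ∈ (0, 1]` and strongly convex flux `f`, whose
initial condition has a derivative bounded by `D`. -/
structure Admissible (f : ℝ → ℝ) (σ D ν : ℝ) (u : ℝ → ℝ → ℝ) : Prop where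
  smooth_flux : ContDiff ℝ ∞ f
  sigma_pos : 0 < σ
  convex : ∀ y, σ ≤ iteratedDeriv 2 f y
  size_pos : 0 < D
  nu_pos : 0 < ν
  nu_le : ν ≤ 1
  solution : IsSolution f ν u
  initial : ∀ x, |iteratedDeriv 1 (u 0) x| ≤ D

lemma hasDerivAt_comp_flux {f g : ℝ → ℝ} (hf : ContDiff ℝ ∞ f) (hg : ContDiff ℝ ∞ g) (x : ℝ) :
    HasDerivAt (f ∘ g) (iteratedDeriv 1 f (g x) * iteratedDeriv 1 g x) x := by
  have h1 := hasDerivAt_iteratedDeriv hf 0 (g x)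
  have h2 := hasDerivAt_iteratedDeriv hg 0 x
  simp only [iteratedDeriv_zero, zero_add] at h1 h2
  exact h1.comp x h2

lemma iteratedDeriv_one_comp {f g : ℝ → ℝ} (hf : ContDiff ℝ ∞ f) (hg : ContDiff ℝ ∞ g) :
    iteratedDeriv 1 (f ∘ g) = fun x => iteratedDeriv 1 f (g x) * iteratedDeriv 1 g x := by
  ext x
  rw [iteratedDeriv_one]
  exact (hasDerivAt_comp_flux hf hg x).deriv

lemma iteratedDeriv_two_comp {f g : ℝ → ℝ} (hf : ContDiff ℝ ∞ f) (hg : ContDiff ℝ ∞ g) (x : ℝ) :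
    iteratedDeriv 2 (f ∘ g) x = iteratedDeriv 2 f (g x) * iteratedDeriv 1 g x ^ 2
      + iteratedDeriv 1 f (g x) * iteratedDeriv 2 g x := by
  rw [iteratedDeriv_succ, iteratedDeriv_one_comp hf hg]
  have h1 : HasDerivAt (fun y => iteratedDeriv 1 f (g y))
      (iteratedDeriv 2 f (g x) * iteratedDeriv 1 g x) x := by
    have h1 := hasDerivAt_iteratedDeriv hf 1 (g x)
    have h2 := hasDerivAt_iteratedDeriv hg 0 x
    simp only [iteratedDeriv_zero, zero_add] at h2
    exact h1.comp x h2
  rw [(h1.fun_mul (hasDerivAt_iteratedDeriv hg 1 x)).deriv]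
  ring

namespace Admissible

variable {f : ℝ → ℝ} {σ D ν : ℝ} {u : ℝ → ℝ → ℝ} (h : Admissible f σ D ν u)
include h

lemma contDiff {t : ℝ} (ht : 0 ≤ t) : ContDiff ℝ ∞ (u t) := h.solution.contDiff ht

lemma hasDerivAt_x {t : ℝ} (ht : 0 ≤ t) (x : ℝ) : HasDerivAt (u t) (iteratedDeriv 1 (u t) x) x := by
  simpa using h.solution.hasDerivAt_space ht 0 x

lemma hasDerivAt_t {t : ℝ} (ht : 0 < t) (x : ℝ) : HasDerivAt (fun s => u s x)
    (ν * iteratedDeriv 2 (u t) x - iteratedDeriv 1 f (u t x) * iteratedDeriv 1 (u t) x) t := by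
  have := h.solution.hasDerivAt_time h.smooth_flux ht 0 x
  simpa [iteratedDeriv_one_comp h.smooth_flux (h.contDiff ht.le)] using this

lemma hasDerivAt_tx {t : ℝ} (ht : 0 < t) (x : ℝ) : HasDerivAt (fun s => iteratedDeriv 1 (u s) x)
    (ν * iteratedDeriv 3 (u t) x - (iteratedDeriv 2 f (u t x) * iteratedDeriv 1 (u t) x ^ 2
      + iteratedDeriv 1 f (u t x) * iteratedDeriv 2 (u t) x)) t := by
  have := h.solution.hasDerivAt_time h.smooth_flux ht 1 x
  rwa [iteratedDeriv_two_comp h.smooth_flux (h.contDiff ht.le)] at this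

lemma deriv_le_size {t : ℝ} (ht : 0 ≤ t) (x : ℝ) : iteratedDeriv 1 (u t) x ≤ D := by
  have key := maximum_principle (z := fun s y => iteratedDeriv 1 (u s) y - D) (a := 0) (b := t)
    (((h.solution.continuousOn 1).mono (prod_mono Icc_subset_Ici_self subset_rfl)).sub
      continuousOn_const)
    (fun s hs y => by simp only [h.solution.periodic_iteratedDeriv hs.1 1 y])
    (fun y => by linarith [(abs_le.1 (h.initial y)).2]) ?_ t ⟨ht, le_rfl⟩ x
  · linarith
  · intro s hs y hpos hmax
    obtain ⟨e1, e2⟩ := deriv_eq_zero_and_second_deriv_nonpos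
      (h.solution.hasDerivAt_space hs.1.le 1) (h.solution.hasDerivAt_space hs.1.le 2 y)
      (fun y' => by linarith [hmax y'])
    refine ⟨_, ?_, (h.hasDerivAt_tx hs.1 y).sub_const D⟩
    simp only [Nat.reduceAdd] at e1 e2
    rw [e1]
    have h1 : 0 < iteratedDeriv 1 (u s) y := by linarith [h.size_pos]
    have h2 : 0 < iteratedDeriv 2 f (u s y) * iteratedDeriv 1 (u s) y ^ 2 :=
      mul_pos (h.sigma_pos.trans_le (h.convex _)) (by positivity)
    nlinarith [h.nu_pos]

/-- Oleinik's one-sided estimate. -/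
lemma deriv_le_inv_time {t : ℝ} (ht : 0 < t) (x : ℝ) : iteratedDeriv 1 (u t) x ≤ 1 / (σ * t) := by
  have hσ := h.sigma_pos
  have key := maximum_principle (z := fun s y => s * iteratedDeriv 1 (u s) y - 1 / σ) (a := 0)
    (b := t) ((continuousOn_fst.mul ((h.solution.continuousOn 1).mono
      (prod_mono Icc_subset_Ici_self subset_rfl))).sub continuousOn_const)
    (fun s hs y => by simp only [h.solution.periodic_iteratedDeriv hs.1 1 y])
    (fun y => by simp [hσ.le]) ?_ t ⟨ht.le, le_rfl⟩ x
  · have h1 : t * iteratedDeriv 1 (u t) x ≤ 1 / σ := by linarith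
    rw [le_div_iff₀ hσ] at h1
    rw [le_div_iff₀ (by positivity)]
    linarith
  · intro s hs y hpos hmax
    have hs0 : 0 < s := hs.1
    obtain ⟨e1, e2⟩ := deriv_eq_zero_and_second_deriv_nonpos
      (h.solution.hasDerivAt_space hs.1.le 1) (h.solution.hasDerivAt_space hs.1.le 2 y)
      (fun y' => by
        have := hmax y'
        exact le_of_mul_le_mul_left (by linarith) hs0)
    refine ⟨_, ?_, ((hasDerivAt_id s).mul (h.hasDerivAt_tx hs.1 y)).sub_const _⟩
    simp only [Nat.reduceAdd] at e1 e2
    rw [e1]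
    simp only [id, mul_zero, add_zero, one_mul]
    set w := iteratedDeriv 1 (u s) y
    have h0 : 1 < s * w * σ := by
      have : 1 / σ < s * w := by linarith
      rwa [div_lt_iff₀ hσ] at this
    have hw : 0 < w := by
      have : 0 < s * w := by
        have : 0 < 1 / σ := by positivity
        linarith
      exact pos_of_mul_pos_right this hs0.le
    have h1 : σ * w ^ 2 ≤ iteratedDeriv 2 f (u s y) * w ^ 2 := by
      gcongr
      exact h.convex _
    have h2 : ν * iteratedDeriv 3 (u s) y ≤ 0 := mul_nonpos_of_nonneg_of_nonpos h.nu_pos.le e2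
    have h3 : s * (ν * iteratedDeriv 3 (u s) y - iteratedDeriv 2 f (u s y) * w ^ 2)
        ≤ s * (-(σ * w ^ 2)) := by
      gcongr
      linarith
    nlinarith

lemma zero_mean {t : ℝ} (ht : 0 ≤ t) : ∫ x in (0 : ℝ)..1, u t x = 0 := by
  rcases ht.eq_or_lt with rfl | ht
  · exact h.solution.zero_mean
  have hder : ∀ s, 0 < s → HasDerivAt (fun s => ∫ x in (0 : ℝ)..1, u s x) 0 s := by
    intro s hs
    have h1 := hasDerivAt_integral (g := fun z => u z.1 z.2)
      (g' := fun z => ν * iteratedDeriv 2 (u z.1) z.2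
        - iteratedDeriv 1 f (u z.1 z.2) * iteratedDeriv 1 (u z.1) z.2)
      h.solution.smooth.continuousOn
      ((continuousOn_const.mul (h.solution.continuousOn 2)).sub
        (((continuous_iteratedDeriv h.smooth_flux 1).comp_continuousOn
          h.solution.smooth.continuousOn).mul (h.solution.continuousOn 1)))
      (fun t ht x => h.hasDerivAt_t ht x) hs
    have h2 : ∫ x in (0 : ℝ)..1, (ν * iteratedDeriv 2 (u s) x
        - iteratedDeriv 1 f (u s x) * iteratedDeriv 1 (u s) x) = 0 := by
      have hcu := h.contDiff hs.le
      refine integral_deriv_periodic (g := fun x => ν * iteratedDeriv 1 (u s) x - (f ∘ u s) x)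
        (fun x => ?_) (fun x => ?_) ?_
      · simp only [Function.comp_apply, h.solution.periodic_iteratedDeriv hs.le 1 x,
          h.solution.periodic s hs.le x]
      · exact ((h.solution.hasDerivAt_space hs.le 1 x).const_mul ν).sub
          (hasDerivAt_comp_flux h.smooth_flux hcu x)
      · exact (continuous_const.mul (continuous_iteratedDeriv hcu 2)).sub
          (((continuous_iteratedDeriv h.smooth_flux 1).comp hcu.continuous).mul
            (continuous_iteratedDeriv hcu 1))
    rwa [h2] at h1
  obtain ⟨s, hs, e⟩ := exists_hasDerivAt_eq_slope (fun s => ∫ x in (0 : ℝ)..1, u s x) (fun _ => 0)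
    ht ((continuousOn_integral h.solution.smooth.continuousOn).mono Icc_subset_Ici_self)
    (fun s hs => hder s hs.1)
  have : (∫ x in (0 : ℝ)..1, u t x) - ∫ x in (0 : ℝ)..1, u 0 x = 0 := by
    rcases div_eq_zero_iff.1 e.symm with h | h
    · exact h
    · linarith
  rw [h.solution.zero_mean] at this
  linarith

lemma abs_le_size {t : ℝ} (ht : 0 ≤ t) (x : ℝ) : |u t x| ≤ D :=
  abs_le_of_deriv_le (h.solution.periodic t ht) (h.hasDerivAt_x ht) (h.zero_mean ht) h.size_pos.le
    (h.deriv_le_size ht) x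

lemma abs_le_inv_time {t : ℝ} (ht : 0 < t) (x : ℝ) : |u t x| ≤ 1 / (σ * t) :=
  abs_le_of_deriv_le (h.solution.periodic t ht.le) (h.hasDerivAt_x ht.le) (h.zero_mean ht.le)
    (by have := h.sigma_pos; positivity) (h.deriv_le_inv_time ht) x

lemma integral_abs_deriv_le {t : ℝ} (ht : 0 ≤ t) :
    ∫ x in (0 : ℝ)..1, |iteratedDeriv 1 (u t) x| ≤ 2 * D :=
  Burgulence.integral_abs_deriv_le (h.solution.periodic t ht) (h.hasDerivAt_x ht)
    (continuous_iteratedDeriv (h.contDiff ht) 1) h.size_pos.le (h.deriv_le_size ht)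

/-- The lower bound for the derivative comes from the maximum principle for
`-u_x - k (2 D ^ 2 - u ^ 2)`: the concavity of `2 D ^ 2 - u ^ 2` turns the viscosity into a damping
term `-2 k ν u_x ^ 2`, which beats the growth term `f''(u) u_x ^ 2` when `k` is of order `ν⁻¹`. -/
lemma abs_deriv_le {F : ℝ} (hF0 : 0 ≤ F) (hF : ∀ y, |y| ≤ D → iteratedDeriv 2 f y ≤ F) {t : ℝ}
    (ht : 0 ≤ t) (x : ℝ) :
    |iteratedDeriv 1 (u t) x| ≤ (2 * D ^ 2 * F + 2 * D) / ν := by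
  have hD := h.size_pos
  have hν := h.nu_pos
  set k : ℝ := (F + 1 / D) / ν with hk
  have hkν : k * ν = F + 1 / D := by rw [hk]; field_simp
  have hk0 : 0 < k := by positivity
  have hG : ∀ s, 0 ≤ s → ∀ y, D ^ 2 ≤ 2 * D ^ 2 - u s y ^ 2 := by
    intro s hs y
    have := sq_le_sq' (abs_le.1 (h.abs_le_size hs y)).1 (abs_le.1 (h.abs_le_size hs y)).2
    linarith
  have hcu := h.solution.smooth.continuousOn
  have key := maximum_principle
    (z := fun s y => -iteratedDeriv 1 (u s) y - k * (2 * D ^ 2 - u s y ^ 2)) (a := 0) (b := t)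
    (((h.solution.continuousOn 1).neg.sub (continuousOn_const.mul (continuousOn_const.sub
      (hcu.pow 2)))).mono (prod_mono Icc_subset_Ici_self subset_rfl))
    (fun s hs y => by
      simp only [h.solution.periodic_iteratedDeriv hs.1 1 y, h.solution.periodic s hs.1 y])
    (fun y => ?_) ?_ t ⟨ht, le_rfl⟩ x
  · have h1 : -iteratedDeriv 1 (u t) x ≤ k * (2 * D ^ 2) := by nlinarith [sq_nonneg (u t x)]
    have h2 : k * (2 * D ^ 2) = (2 * D ^ 2 * F + 2 * D) / ν := by
      rw [hk]; field_simp
    rw [abs_le]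
    refine ⟨by linarith, (h.deriv_le_size ht x).trans ?_⟩
    rw [le_div_iff₀ hν]
    nlinarith [h.nu_le, mul_nonneg (sq_nonneg D) hF0]
  · have h1 := (abs_le.1 (h.initial y)).1
    have h2 : k * D ^ 2 ≤ k * (2 * D ^ 2 - u 0 y ^ 2) := by
      gcongr
      exact hG 0 le_rfl y
    have h3 : 1 / D ≤ k := by
      rw [hk, le_div_iff₀ hν]
      have : 0 < 1 / D := by positivity
      nlinarith [h.nu_le]
    have h4 : D = 1 / D * D ^ 2 := by field_simp
    nlinarith [sq_nonneg D]
  · intro s hs y hpos hmax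
    have hs0 : 0 ≤ s := hs.1.le
    obtain ⟨e1, e2⟩ := deriv_eq_zero_and_second_deriv_nonpos
      (g := fun y => -iteratedDeriv 1 (u s) y - k * (2 * D ^ 2 - u s y ^ 2))
      (g' := fun y => -iteratedDeriv 2 (u s) y + k * (2 * u s y * iteratedDeriv 1 (u s) y))
      (c := -iteratedDeriv 3 (u s) y + k * (2 * iteratedDeriv 1 (u s) y * iteratedDeriv 1 (u s) y
        + 2 * u s y * iteratedDeriv 2 (u s) y)) (x := y)
      (fun y' => by
        have := ((h.solution.hasDerivAt_space hs0 1 y').neg).sub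
          ((((h.hasDerivAt_x hs0 y').pow 2).const_sub (2 * D ^ 2)).const_mul k)
        refine this.congr_deriv ?_
        push_cast
        ring)
      ((h.solution.hasDerivAt_space hs0 2 y).neg.add
        ((((h.hasDerivAt_x hs0 y).const_mul 2).mul
          (h.solution.hasDerivAt_space hs0 1 y)).const_mul k)) hmax
    refine ⟨_, ?_, (h.hasDerivAt_tx hs.1 y).neg.sub
      ((((h.hasDerivAt_t hs.1 y).pow 2).const_sub (2 * D ^ 2)).const_mul k)⟩
    have hw : iteratedDeriv 1 (u s) y < 0 := by nlinarith [hG s hs0 y, sq_nonneg D]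
    have hF' := hF _ (h.abs_le_size hs0 y)
    set w := iteratedDeriv 1 (u s) y
    set w₂ := iteratedDeriv 2 (u s) y
    set w₃ := iteratedDeriv 3 (u s) y
    set v := u s y
    set a := iteratedDeriv 1 f v
    set b := iteratedDeriv 2 f v
    have hw2 : 0 < w ^ 2 := by nlinarith
    have h1 : (b - 2 * (k * ν)) * w ^ 2 < 0 := by
      apply mul_neg_of_neg_of_pos _ hw2
      rw [hkν]
      have : 0 < 1 / D := by positivity
      linarith
    have h2 : ν * (-w₃ + k * (2 * w * w + 2 * v * w₂)) ≤ 0 :=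
      mul_nonpos_of_nonneg_of_nonpos hν.le e2
    have h3 : a * (-w₂ + k * (2 * v * w)) = 0 := by rw [e1, mul_zero]
    calc _ = ν * (-w₃ + k * (2 * w * w + 2 * v * w₂)) - a * (-w₂ + k * (2 * v * w))
          + (b - 2 * (k * ν)) * w ^ 2 := by
            push_cast
            ring
      _ < 0 := by linarith

end Admissible

/-! ### Derivatives of a composition -/

lemma exists_bound_derivatives {f : ℝ → ℝ} (hf : ContDiff ℝ ∞ f) (D : ℝ) (n : ℕ) :
    ∃ B : ℝ, 0 < B ∧ ∀ i ≤ n, ∀ y, |y| ≤ D → |iteratedDeriv i f y| ≤ B := by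
  have h1 : ∀ i, ∃ B : ℝ, ∀ y ∈ Icc (-D) D, ‖iteratedDeriv i f y‖ ≤ B := fun i =>
    isCompact_Icc.exists_bound_of_continuousOn (continuous_iteratedDeriv hf i).continuousOn
  choose B hB using h1
  refine ⟨1 + ∑ i ∈ Finset.range (n + 1), |B i|, by positivity, fun i hi y hy => ?_⟩
  have h2 := hB i y (abs_le.1 hy)
  have h3 := Finset.single_le_sum (f := fun i => |B i|) (fun i _ => abs_nonneg _)
    (Finset.mem_range.2 (Nat.lt_succ_of_le hi))
  rw [Real.norm_eq_abs] at h2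
  linarith [le_abs_self (B i)]

lemma abs_iteratedDeriv_comp_le {f : ℝ → ℝ} (hf : ContDiff ℝ ∞ f) (D : ℝ) (n : ℕ) :
    ∃ C : ℝ, 0 < C ∧ ∀ (g : ℝ → ℝ) (x R : ℝ), ContDiff ℝ ∞ g → |g x| ≤ D →
      (∀ i, 1 ≤ i → i ≤ n → |iteratedDeriv i g x| ≤ R ^ i) →
      |iteratedDeriv n (f ∘ g) x| ≤ C * R ^ n := by
  obtain ⟨B, hB, hBf⟩ := exists_bound_derivatives hf D n
  refine ⟨n.factorial * B, by positivity, fun g x R hg hgx hR => ?_⟩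
  have := norm_iteratedFDeriv_comp_le (n := n) hf hg (by exact_mod_cast le_top) x (C := B) (D := R)
    (fun i hi => by
      rw [norm_iteratedFDeriv_eq_norm_iteratedDeriv]
      exact hBf i hi _ hgx)
    (fun i h1 hi => by
      rw [norm_iteratedFDeriv_eq_norm_iteratedDeriv]
      exact hR i h1 hi)
  rwa [norm_iteratedFDeriv_eq_norm_iteratedDeriv] at this

lemma iteratedDeriv_succ_comp {f g : ℝ → ℝ} (hf : ContDiff ℝ ∞ f) (hg : ContDiff ℝ ∞ g) (n : ℕ)
    (x : ℝ) : iteratedDeriv (n + 1) (f ∘ g) x = ∑ i ∈ Finset.range (n + 1),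
      (n.choose i : ℝ) * iteratedDeriv i (iteratedDeriv 1 f ∘ g) x
        * iteratedDeriv (n - i + 1) g x := by
  have e : deriv (f ∘ g) = (iteratedDeriv 1 f ∘ g) * iteratedDeriv 1 g := by
    ext y
    exact (hasDerivAt_comp_flux hf hg y).deriv
  have hle : ((n : ℕ) : WithTop ℕ∞) ≤ ((⊤ : ℕ∞) : WithTop ℕ∞) := by exact_mod_cast le_top
  rw [iteratedDeriv_succ', e, iteratedDeriv_mul
    (((contDiff_iteratedDeriv hf 1).comp hg).of_le hle).contDiffAt
    ((contDiff_iteratedDeriv hg 1).of_le hle).contDiffAt]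
  refine Finset.sum_congr rfl fun i _ => ?_
  rw [iteratedDeriv_succ' (n := n - i), iteratedDeriv_one (f := g)]

/-- In the derivative of order `n + 1` of `f ∘ g`, all terms but `f'(g) g⁽ⁿ⁺¹⁾` contain derivatives of
`g` of order at most `n` only. -/
lemma abs_iteratedDeriv_comp_sub_le {f : ℝ → ℝ} (hf : ContDiff ℝ ∞ f) (D : ℝ) (n : ℕ) :
    ∃ C : ℝ, 0 < C ∧ ∀ (g : ℝ → ℝ) (x R : ℝ), ContDiff ℝ ∞ g → |g x| ≤ D → 0 ≤ R →
      (∀ i, 1 ≤ i → i ≤ n → |iteratedDeriv i g x| ≤ R ^ i) →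
      |iteratedDeriv (n + 1) (f ∘ g) x - iteratedDeriv 1 f (g x) * iteratedDeriv (n + 1) g x|
        ≤ C * R ^ (n + 1) := by
  choose C hC hCf using abs_iteratedDeriv_comp_le (contDiff_iteratedDeriv hf 1) D
  refine ⟨1 + ∑ i ∈ Finset.range n, n.choose (i + 1) * C (i + 1), ?_, fun g x R hg hgx hR hi => ?_⟩
  · have := Finset.sum_nonneg (s := Finset.range n)
      (f := fun i => (n.choose (i + 1) : ℝ) * C (i + 1))
      (fun i _ => mul_nonneg (Nat.cast_nonneg _) (hC _).le)
    linarith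
  rw [iteratedDeriv_succ_comp hf hg, Finset.sum_range_succ']
  simp only [Nat.choose_zero_right, Nat.cast_one, one_mul, iteratedDeriv_zero,
    Function.comp_apply, Nat.sub_zero, add_sub_cancel_right]
  calc _ ≤ ∑ i ∈ Finset.range n, |(n.choose (i + 1) : ℝ)
          * iteratedDeriv (i + 1) (iteratedDeriv 1 f ∘ g) x * iteratedDeriv (n - (i + 1) + 1) g x| :=
        Finset.abs_sum_le_sum_abs _ _
    _ ≤ ∑ i ∈ Finset.range n, (n.choose (i + 1) * C (i + 1)) * R ^ (n + 1) := by
        refine Finset.sum_le_sum fun i hin => ?_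
        have hin' := Finset.mem_range.1 hin
        rw [abs_mul, abs_mul, Nat.abs_cast]
        have h1 := hCf (i + 1) g x R hg hgx (fun k h1 h2 => hi k h1 (by omega))
        have h2 := hi (n - (i + 1) + 1) (by omega) (by omega)
        have h3 : R ^ (n + 1) = R ^ (i + 1) * R ^ (n - (i + 1) + 1) := by
          rw [← pow_add]; congr 1; omega
        have := (hC (i + 1)).le
        rw [h3]
        calc _ ≤ (n.choose (i + 1) : ℝ) * (C (i + 1) * R ^ (i + 1)) * R ^ (n - (i + 1) + 1) := by
              gcongr
          _ = _ := by ring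
    _ ≤ _ := by
        rw [← Finset.sum_mul]
        gcongr
        linarith

/-- The derivative of order `n + 2` of `f ∘ g`, for `n ≥ 1`, depends linearly on `g⁽ⁿ⁺¹⁾`. -/
lemma abs_iteratedDeriv_comp_sub_le_linear {f : ℝ → ℝ} (hf : ContDiff ℝ ∞ f) (D : ℝ) {n : ℕ}
    (hn : 1 ≤ n) :
    ∃ C : ℝ, 0 < C ∧ ∀ (g : ℝ → ℝ) (x R : ℝ), ContDiff ℝ ∞ g → |g x| ≤ D → 0 ≤ R →
      (∀ i, 1 ≤ i → i ≤ n → |iteratedDeriv i g x| ≤ R ^ i) →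
      |iteratedDeriv (n + 2) (f ∘ g) x - iteratedDeriv 1 f (g x) * iteratedDeriv (n + 2) g x|
        ≤ C * (R * |iteratedDeriv (n + 1) g x| + R ^ (n + 2)) := by
  have hf1 := contDiff_iteratedDeriv hf 1
  choose C hC hCf using abs_iteratedDeriv_comp_le hf1 D
  obtain ⟨C', hC', hCf'⟩ := abs_iteratedDeriv_comp_sub_le hf1 D n
  obtain ⟨B, hB, hBf⟩ := exists_bound_derivatives hf1 D 1
  refine ⟨(B + C') + ∑ i ∈ Finset.range n, (n + 1).choose (i + 1) * C (i + 1), ?_,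
    fun g x R hg hgx hR hi => ?_⟩
  · have := Finset.sum_nonneg (s := Finset.range n)
      (f := fun i => ((n + 1).choose (i + 1) : ℝ) * C (i + 1))
      (fun i _ => mul_nonneg (Nat.cast_nonneg _) (hC _).le)
    linarith
  set X := R * |iteratedDeriv (n + 1) g x| + R ^ (n + 2) with hX
  have hX0 : 0 ≤ X := by positivity
  rw [iteratedDeriv_succ_comp hf hg, Finset.sum_range_succ', Finset.sum_range_succ]
  simp only [Nat.choose_zero_right, Nat.choose_self, Nat.cast_one, one_mul, iteratedDeriv_zero,
    Function.comp_apply, Nat.sub_zero, add_sub_cancel_right, Nat.sub_self, zero_add]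
  -- the term in which all derivatives but one fall on `f' ∘ g`
  have hlast : |iteratedDeriv (n + 1) (iteratedDeriv 1 f ∘ g) x * iteratedDeriv 1 g x|
      ≤ (B + C') * X := by
    have h1 := hCf' g x R hg hgx hR hi
    have h2 := hBf 1 le_rfl (g x) hgx
    have h3 := hi 1 le_rfl hn
    rw [pow_one] at h3
    have h4 : |iteratedDeriv (n + 1) (iteratedDeriv 1 f ∘ g) x|
        ≤ B * |iteratedDeriv (n + 1) g x| + C' * R ^ (n + 1) := by
      have h5 := abs_sub_abs_le_abs_sub (iteratedDeriv (n + 1) (iteratedDeriv 1 f ∘ g) x)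
        (iteratedDeriv 1 (iteratedDeriv 1 f) (g x) * iteratedDeriv (n + 1) g x)
      rw [abs_mul (iteratedDeriv 1 (iteratedDeriv 1 f) (g x))] at h5
      have h6 := mul_le_mul_of_nonneg_right h2 (abs_nonneg (iteratedDeriv (n + 1) g x))
      linarith
    rw [abs_mul]
    calc _ ≤ (B * |iteratedDeriv (n + 1) g x| + C' * R ^ (n + 1)) * R := by gcongr
      _ = B * (R * |iteratedDeriv (n + 1) g x|) + C' * R ^ (n + 2) := by ring
      _ ≤ B * X + C' * X := by
          have : 0 ≤ R * |iteratedDeriv (n + 1) g x| := by positivity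
          have : 0 ≤ R ^ (n + 2) := by positivity
          gcongr <;> linarith
      _ = (B + C') * X := by ring
  have hmid : |∑ i ∈ Finset.range n, ((n + 1).choose (i + 1) : ℝ)
      * iteratedDeriv (i + 1) (iteratedDeriv 1 f ∘ g) x
      * iteratedDeriv (n + 1 - (i + 1) + 1) g x|
      ≤ (∑ i ∈ Finset.range n, (n + 1).choose (i + 1) * C (i + 1)) * X := by
    rw [Finset.sum_mul]
    refine (Finset.abs_sum_le_sum_abs _ _).trans (Finset.sum_le_sum fun i hin => ?_)
    have hin' := Finset.mem_range.1 hin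
    rw [abs_mul, abs_mul, Nat.abs_cast]
    have h1 := hCf (i + 1) g x R hg hgx (fun k h1 h2 => hi k h1 (by omega))
    have h2 : R ^ (i + 1) * |iteratedDeriv (n + 1 - (i + 1) + 1) g x| ≤ X := by
      rcases Nat.eq_zero_or_pos i with rfl | hi0
      · have : 0 ≤ R ^ (n + 2) := by positivity
        simp only [zero_add, pow_one, Nat.add_sub_cancel]
        linarith
      · have h3 := hi (n + 1 - (i + 1) + 1) (by omega) (by omega)
        have h4 : R ^ (n + 2) = R ^ (i + 1) * R ^ (n + 1 - (i + 1) + 1) := by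
          rw [← pow_add]; congr 1; omega
        have h5 : 0 ≤ R * |iteratedDeriv (n + 1) g x| := by positivity
        have h6 := mul_le_mul_of_nonneg_left h3 (pow_nonneg hR (i + 1))
        linarith
    have := (hC (i + 1)).le
    calc _ ≤ ((n + 1).choose (i + 1) : ℝ) * (C (i + 1) * R ^ (i + 1))
          * |iteratedDeriv (n + 1 - (i + 1) + 1) g x| := by gcongr
      _ = ((n + 1).choose (i + 1) : ℝ) * C (i + 1)
          * (R ^ (i + 1) * |iteratedDeriv (n + 1 - (i + 1) + 1) g x|) := by ring
      _ ≤ _ := by gcongr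
  calc _ ≤ _ := abs_add_le _ _
    _ ≤ _ := add_le_add hmid hlast
    _ = _ := by ring

/-! ### Pointwise bounds for all derivatives -/

namespace Admissible

variable {f : ℝ → ℝ} {σ D ν : ℝ} {u : ℝ → ℝ → ℝ} (h : Admissible f σ D ν u)
include h

set_option maxHeartbeats 1000000 in
-- the differential inequality at a maximum involves many auxiliary quantities
/-- Bernstein's method on a time window of length `μ / 2`: the maximum principle is applied to
`(s - s₀) w ^ 2 + A v ^ 2`, where `v` and `w = v_x` are consecutive derivatives of the solution. The
viscous term of `v ^ 2` absorbs the growth of `w ^ 2`. Here `S` is the expected size of `w` and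
`R = L / μ` that of an `x`-derivative. -/
lemma bernstein {k : ℕ} {μ t L R S C₁ C₂ : ℝ} (hμ : 0 < μ) (hμν : μ ≤ ν) (hμt : μ ≤ t)
    (hL : 0 < L) (hRL : R = L / μ) (hS : 0 < S) (hC₁ : 0 < C₁) (hC₂ : 0 < C₂)
    (hv : ∀ s ∈ Icc (t - μ / 2) t, ∀ x, |iteratedDeriv k (u s) x| * R ≤ S)
    (h1 : ∀ s ∈ Icc (t - μ / 2) t, ∀ x, |iteratedDeriv (k + 1) (f ∘ u s) x
      - iteratedDeriv 1 f (u s x) * iteratedDeriv (k + 1) (u s) x| ≤ C₁ * S)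
    (h2 : ∀ s ∈ Icc (t - μ / 2) t, ∀ x, |iteratedDeriv (k + 2) (f ∘ u s) x
      - iteratedDeriv 1 f (u s x) * iteratedDeriv (k + 2) (u s) x|
        ≤ C₂ * R * (|iteratedDeriv (k + 1) (u s) x| + S)) (x : ℝ) :
    iteratedDeriv (k + 1) (u t) x ^ 2 ≤
      ((1 + 2 * C₂ * L) / L ^ 2 + (C₂ * L + (1 + 2 * C₂ * L) * C₁ / L + 1)) * S ^ 2 := by
  have hR : 0 < R := by rw [hRL]; positivity
  have hRμ : R * μ = L := by rw [hRL]; field_simp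
  have hν := h.nu_pos
  set a : ℝ := (1 + 2 * C₂ * L) / 2 with ha
  have ha0 : 0 < a := by positivity
  set A : ℝ := a / μ with hA
  have hA0 : 0 < A := by positivity
  have hAμ : A * μ = a := by rw [hA]; field_simp
  set B : ℝ := (C₂ * L + 2 * a * C₁ / L + 1) * S ^ 2 with hB
  set s₀ : ℝ := t - μ / 2 with hs₀
  have hs₀pos : 0 < s₀ := by rw [hs₀]; linarith
  have hwin : ∀ s ∈ Icc s₀ t, 0 ≤ s := fun s hs => hs₀pos.le.trans hs.1
  have hcont : ∀ m, ContinuousOn (fun q : ℝ × ℝ => iteratedDeriv m (u q.1) q.2)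
      (Icc s₀ t ×ˢ univ) := fun m =>
    (h.solution.continuousOn m).mono (prod_mono (fun s hs => hwin s hs) subset_rfl)
  have key := maximum_principle
    (z := fun s y => (s - s₀) * iteratedDeriv (k + 1) (u s) y ^ 2 + A * iteratedDeriv k (u s) y ^ 2
      - (A * (S / R) ^ 2 + B * (s - s₀))) (a := s₀) (b := t)
    ((((continuousOn_fst.sub continuousOn_const).mul ((hcont (k + 1)).pow 2)).add
      (continuousOn_const.mul ((hcont k).pow 2))).sub
      (continuousOn_const.add (continuousOn_const.mul (continuousOn_fst.sub continuousOn_const))))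
    (fun s hs y => by
      simp only [h.solution.periodic_iteratedDeriv (hwin s hs) k y,
        h.solution.periodic_iteratedDeriv (hwin s hs) (k + 1) y])
    (fun y => ?_) ?_ t ⟨by rw [hs₀]; linarith, le_rfl⟩ x
  · have e1 : t - s₀ = μ / 2 := by rw [hs₀]; ring
    rw [e1] at key
    have h3 : 0 ≤ A * iteratedDeriv k (u t) x ^ 2 := by positivity
    have h4 : μ / 2 * iteratedDeriv (k + 1) (u t) x ^ 2 ≤ A * (S / R) ^ 2 + B * (μ / 2) := by
      linarith
    have h5 : A * (S / R) ^ 2 + B * (μ / 2) = μ / 2 * (((1 + 2 * C₂ * L) / L ^ 2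
        + (C₂ * L + (1 + 2 * C₂ * L) * C₁ / L + 1)) * S ^ 2) := by
      rw [hB, hA, ha, hRL]
      field_simp
    rw [h5] at h4
    exact le_of_mul_le_mul_left h4 (by positivity)
  · have h3 := hv s₀ ⟨le_rfl, by rw [hs₀]; linarith⟩ y
    rw [← le_div_iff₀ hR] at h3
    have h4 : iteratedDeriv k (u s₀) y ^ 2 ≤ (S / R) ^ 2 := by
      rw [← sq_abs]
      gcongr
    have h5 := mul_le_mul_of_nonneg_left h4 hA0.le
    simp only [sub_self, zero_mul, mul_zero]
    linarith
  · intro s hs y _ hmax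
    have hs' : s ∈ Icc s₀ t := Ioc_subset_Icc_self hs
    have hs0 : 0 ≤ s := hwin s hs'
    have hspos : 0 < s := hs₀pos.trans hs.1
    have hx := fun m y => h.solution.hasDerivAt_space hs0 m y
    set τ : ℝ := s - s₀ with hτ
    have hτ0 : 0 < τ := by rw [hτ]; linarith [hs.1]
    have hτμ : τ ≤ μ / 2 := by rw [hτ, hs₀]; linarith [hs.2]
    obtain ⟨e1, e2⟩ := deriv_eq_zero_and_second_deriv_nonpos
      (g := fun y => τ * iteratedDeriv (k + 1) (u s) y ^ 2 + A * iteratedDeriv k (u s) y ^ 2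
        - (A * (S / R) ^ 2 + B * τ))
      (g' := fun y => τ * (2 * iteratedDeriv (k + 1) (u s) y * iteratedDeriv (k + 2) (u s) y)
        + A * (2 * iteratedDeriv k (u s) y * iteratedDeriv (k + 1) (u s) y))
      (c := τ * (2 * iteratedDeriv (k + 2) (u s) y * iteratedDeriv (k + 2) (u s) y
          + 2 * iteratedDeriv (k + 1) (u s) y * iteratedDeriv (k + 3) (u s) y)
        + A * (2 * iteratedDeriv (k + 1) (u s) y * iteratedDeriv (k + 1) (u s) y
          + 2 * iteratedDeriv k (u s) y * iteratedDeriv (k + 2) (u s) y)) (x := y)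
      (fun y' => by
        refine (((((hx (k + 1) y').pow 2).const_mul τ).add
          (((hx k y').pow 2).const_mul A)).sub_const _).congr_deriv ?_
        push_cast
        ring)
      (((((hx (k + 1) y).const_mul 2).mul (hx (k + 2) y)).const_mul τ).add
        ((((hx k y).const_mul 2).mul (hx (k + 1) y)).const_mul A)) hmax
    have hv' := hv s hs' y
    have h1' := h1 s hs' y
    have h2' := h2 s hs' y
    have ht0 : HasDerivAt (fun s => iteratedDeriv k (u s) y) (ν * iteratedDeriv (k + 2) (u s) y
        - iteratedDeriv (k + 1) (f ∘ u s) y) s :=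
      h.solution.hasDerivAt_time h.smooth_flux hspos k y
    have ht1 : HasDerivAt (fun s => iteratedDeriv (k + 1) (u s) y)
        (ν * iteratedDeriv (k + 3) (u s) y - iteratedDeriv (k + 2) (f ∘ u s) y) s :=
      h.solution.hasDerivAt_time h.smooth_flux hspos (k + 1) y
    set E₁ := iteratedDeriv (k + 1) (f ∘ u s) y
      - iteratedDeriv 1 f (u s y) * iteratedDeriv (k + 1) (u s) y with hE₁
    set E₂ := iteratedDeriv (k + 2) (f ∘ u s) y
      - iteratedDeriv 1 f (u s y) * iteratedDeriv (k + 2) (u s) y with hE₂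
    set b := iteratedDeriv 1 f (u s y)
    set v := iteratedDeriv k (u s) y with hvdef
    set w := iteratedDeriv (k + 1) (u s) y with hwdef
    set w₂ := iteratedDeriv (k + 2) (u s) y
    set w₃ := iteratedDeriv (k + 3) (u s) y
    have e3 : iteratedDeriv (k + 1) (f ∘ u s) y = b * w + E₁ := by rw [hE₁]; ring
    have e4 : iteratedDeriv (k + 2) (f ∘ u s) y = b * w₂ + E₂ := by rw [hE₂]; ring
    rw [e3] at ht0
    rw [e4] at ht1
    have hτd : HasDerivAt (fun s => s - s₀) 1 s := (hasDerivAt_id s).sub_const s₀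
    refine ⟨w ^ 2 + τ * (2 * w * (ν * w₃ - (b * w₂ + E₂)))
      + A * (2 * v * (ν * w₂ - (b * w + E₁))) - B, ?_,
      (((hτd.fun_mul (ht1.fun_pow 2)).fun_add ((ht0.fun_pow 2).const_mul A)).fun_sub
        ((hτd.const_mul B).const_add (A * (S / R) ^ 2))).congr_deriv ?_⟩
    swap
    · rw [← hvdef, ← hwdef, ← hτ]
      push_cast
      ring
    have b1 : 2 * τ * (-(w * E₂)) ≤ 2 * C₂ * L * w ^ 2 + C₂ * L * S ^ 2 := by
      have c1 : -(w * E₂) ≤ |w| * (C₂ * R * (|w| + S)) :=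
        (neg_le_abs _).trans (by rw [abs_mul]; gcongr)
      have c2 : |w| * (|w| + S) ≤ 2 * w ^ 2 + S ^ 2 := by
        rw [← sq_abs w]
        nlinarith [sq_nonneg (|w| - S)]
      calc 2 * τ * (-(w * E₂)) ≤ 2 * τ * (|w| * (C₂ * R * (|w| + S))) := by gcongr
        _ = 2 * τ * (C₂ * R * (|w| * (|w| + S))) := by ring
        _ ≤ 2 * (μ / 2) * (C₂ * R * (|w| * (|w| + S))) := by gcongr
        _ = C₂ * (R * μ) * (|w| * (|w| + S)) := by ring
        _ ≤ C₂ * L * (2 * w ^ 2 + S ^ 2) := by rw [hRμ]; gcongr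
        _ = _ := by ring
    have b2 : 2 * A * (-(v * E₁)) ≤ 2 * a * C₁ / L * S ^ 2 := by
      have c1 : -(v * E₁) ≤ S / R * (C₁ * S) :=
        (neg_le_abs _).trans (by
          rw [abs_mul]
          rw [← le_div_iff₀ hR] at hv'
          gcongr)
      calc 2 * A * (-(v * E₁)) ≤ 2 * A * (S / R * (C₁ * S)) := by gcongr
        _ = _ := by rw [hA, hRL]; field_simp
    have b3 : w ^ 2 + 2 * C₂ * L * w ^ 2 ≤ 2 * A * ν * w ^ 2 := by
      have : a ≤ A * ν := by rw [← hAμ]; gcongr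
      have h3 : 1 + 2 * C₂ * L = 2 * a := by rw [ha]; ring
      nlinarith [sq_nonneg w]
    have b4 : ν * (τ * (2 * w₂ * w₂ + 2 * w * w₃) + A * (2 * w * w + 2 * v * w₂)) ≤ 0 :=
      mul_nonpos_of_nonneg_of_nonpos hν.le e2
    have b5 : b * (τ * (2 * w * w₂) + A * (2 * v * w)) = 0 := by rw [e1, mul_zero]
    have b6 : 0 ≤ 2 * ν * τ * w₂ ^ 2 := by positivity
    have b7 : 0 < S ^ 2 := by positivity
    have b8 : B = C₂ * L * S ^ 2 + 2 * a * C₁ / L * S ^ 2 + S ^ 2 := by rw [hB]; ring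
    calc _ = ν * (τ * (2 * w₂ * w₂ + 2 * w * w₃) + A * (2 * w * w + 2 * v * w₂))
          - b * (τ * (2 * w * w₂) + A * (2 * v * w)) - 2 * ν * τ * w₂ ^ 2
          + (w ^ 2 - 2 * A * ν * w ^ 2 + 2 * τ * (-(w * E₂)) + 2 * A * (-(v * E₁)) - B) := by ring
      _ < 0 := by linarith

end Admissible

/-- The derivative of order `n` of a solution is at most of order `min(t, ν)⁻ⁿ`. -/
lemma exists_abs_iteratedDeriv_le_scale {f : ℝ → ℝ} (hf : ContDiff ℝ ∞ f) (σ D : ℝ) (n : ℕ) :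
    ∃ C : ℝ, 0 < C ∧ ∀ (ν : ℝ) (u : ℝ → ℝ → ℝ), Admissible f σ D ν u → ∀ t, 0 < t → ∀ x,
      |iteratedDeriv n (u t) x| ≤ C / min t ν ^ n := by
  induction n using Nat.strong_induction_on with
  | _ n ih =>
  match n, ih with
  | 0, _ =>
    refine ⟨|D| + 1, by positivity, fun ν u h t ht x => ?_⟩
    have := h.abs_le_size ht.le x
    simp only [iteratedDeriv_zero, pow_zero, div_one]
    linarith [le_abs_self D]
  | 1, _ =>
    obtain ⟨F, hF, hFf⟩ := exists_bound_derivatives hf D 2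
    refine ⟨2 * D ^ 2 * F + 2 * |D| + 1, by positivity, fun ν u h t ht x => ?_⟩
    have h1 := h.abs_deriv_le hF.le (fun y hy => (abs_le.1 (hFf 2 le_rfl y hy)).2) ht.le x
    have hν := h.nu_pos
    refine h1.trans ?_
    rw [pow_one]
    have : 0 < min t ν := lt_min ht hν
    have hD : 2 * D ^ 2 * F + 2 * D ≤ 2 * D ^ 2 * F + 2 * |D| + 1 := by linarith [le_abs_self D]
    exact div_le_div₀ (by positivity) hD this (min_le_right _ _)
  | k + 2, ih =>
    have ih' : ∀ i, ∃ C : ℝ, i < k + 2 → 0 < C ∧ ∀ (ν : ℝ) (u : ℝ → ℝ → ℝ),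
        Admissible f σ D ν u → ∀ t, 0 < t → ∀ x,
          |iteratedDeriv i (u t) x| ≤ C / min t ν ^ i := by
      intro i
      by_cases hi : i < k + 2
      · obtain ⟨C, hC⟩ := ih i hi
        exact ⟨C, fun _ => hC⟩
      · exact ⟨0, fun h => absurd h hi⟩
    choose C hC using ih'
    set M : ℝ := 1 + ∑ i ∈ Finset.range (k + 2), |C i| with hM
    have hM1 : 1 ≤ M := by
      have : 0 ≤ ∑ i ∈ Finset.range (k + 2), |C i| := Finset.sum_nonneg fun _ _ => abs_nonneg _
      linarith
    have hCM : ∀ i < k + 2, C i ≤ M := by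
      intro i hi
      have := Finset.single_le_sum (f := fun i => |C i|) (fun i _ => abs_nonneg _)
        (Finset.mem_range.2 hi)
      linarith [le_abs_self (C i)]
    obtain ⟨C₁, hC₁, H₁⟩ := abs_iteratedDeriv_comp_sub_le hf D (k + 1)
    obtain ⟨C₂, hC₂, H₂⟩ := abs_iteratedDeriv_comp_sub_le_linear hf D (Nat.le_add_left 1 k)
    set L : ℝ := 2 * M with hL
    have hL0 : 0 < L := by linarith
    set K : ℝ := (1 + 2 * C₂ * L) / L ^ 2 + (C₂ * L + (1 + 2 * C₂ * L) * C₁ / L + 1) with hK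
    have hK0 : 0 < K := by positivity
    refine ⟨(K + 1) * L ^ (k + 2), by positivity, fun ν u h t ht x => ?_⟩
    set μ := min t ν with hμ
    have hμ0 : 0 < μ := lt_min ht h.nu_pos
    have hμt : μ ≤ t := min_le_left _ _
    have hμν : μ ≤ ν := min_le_right _ _
    have hR0 : 0 < L / μ := by positivity
    have hpos : ∀ s ∈ Icc (t - μ / 2) t, 0 < s := fun s hs => by linarith [hs.1]
    have hlow : ∀ s ∈ Icc (t - μ / 2) t, ∀ y, ∀ i, 1 ≤ i → i ≤ k + 1 →
        |iteratedDeriv i (u s) y| ≤ (L / μ) ^ i := by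
      intro s hs y i h1 hi
      have hmin : μ / 2 ≤ min s ν := le_min (by linarith [hs.1]) (by linarith)
      have h2 := (hC i (by omega)).2 ν u h s (hpos s hs) y
      calc _ ≤ C i / min s ν ^ i := h2
        _ ≤ M ^ i / (μ / 2) ^ i := by
            have : C i ≤ M ^ i := (hCM i (by omega)).trans (le_self_pow₀ hM1 (by omega))
            gcongr
        _ = (L / μ) ^ i := by
            rw [hL, ← div_pow]
            congr 1
            field_simp
    have hDs : ∀ s ∈ Icc (t - μ / 2) t, ∀ y, |u s y| ≤ D := fun s hs y =>
      h.abs_le_size (hpos s hs).le y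
    have key := h.bernstein (k := k + 1) (S := (L / μ) ^ (k + 2)) hμ0 hμν hμt hL0 rfl
      (by positivity) hC₁ hC₂
      (fun s hs y => by
        rw [pow_succ _ (k + 1)]
        gcongr
        exact hlow s hs y (k + 1) (by omega) le_rfl)
      (fun s hs y => H₁ (u s) y (L / μ) (h.contDiff (hpos s hs).le) (hDs s hs y) hR0.le
        (hlow s hs y))
      (fun s hs y => by
        refine (H₂ (u s) y (L / μ) (h.contDiff (hpos s hs).le) (hDs s hs y) hR0.le
          (hlow s hs y)).trans (le_of_eq ?_)
        ring)
      x
    rw [← hK] at key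
    have h3 : iteratedDeriv (k + 2) (u t) x ^ 2 ≤ ((K + 1) * (L / μ) ^ (k + 2)) ^ 2 := by
      refine key.trans ?_
      rw [mul_pow]
      gcongr
      nlinarith
    calc _ ≤ (K + 1) * (L / μ) ^ (k + 2) := abs_le_of_sq_le_sq h3 (by positivity)
      _ = _ := by rw [div_pow]; ring

/-! ### The norms `|v|_{m,p}` of smooth functions -/

/-- Lebesgue measure on one period. -/
noncomputable abbrev periodMeasure : Measure ℝ := volume.restrict (Ioc (0 : ℝ) 1)

instance : IsProbabilityMeasure periodMeasure := ⟨by simp⟩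

lemma memLp_period {g : ℝ → ℝ} (hg : Continuous g) (p : ℝ≥0∞) : MemLp g p periodMeasure := by
  obtain ⟨B, hB⟩ := isCompact_Icc.exists_bound_of_continuousOn (hg.continuousOn (s := Icc 0 1))
  refine MemLp.of_bound hg.aestronglyMeasurable B ?_
  filter_upwards [ae_restrict_mem measurableSet_Ioc] with x hx
  exact hB x (Ioc_subset_Icc_self hx)

lemma sobolevNorm_nonneg (m : ℕ) (p : ℝ≥0∞) (v : ℝ → ℝ) : 0 ≤ sobolevNorm m p v :=
  ENNReal.toReal_nonneg

lemma eLpNorm_period_toReal_le {g : ℝ → ℝ} {B : ℝ} (hB : 0 ≤ B)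
    (h : ∀ x ∈ Icc (0 : ℝ) 1, |g x| ≤ B) (p : ℝ≥0∞) : (eLpNorm g p periodMeasure).toReal ≤ B := by
  have h1 : eLpNorm g p periodMeasure ≤ periodMeasure univ ^ p.toReal⁻¹ * ENNReal.ofReal B := by
    refine eLpNorm_le_of_ae_bound ?_
    filter_upwards [ae_restrict_mem measurableSet_Ioc] with x hx
    exact h x (Ioc_subset_Icc_self hx)
  rw [measure_univ, ENNReal.one_rpow, one_mul] at h1
  exact ENNReal.toReal_le_of_le_ofReal hB h1

lemma sobolevNorm_le {v : ℝ → ℝ} {m : ℕ} {B : ℝ} (hB : 0 ≤ B)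
    (h : ∀ x, |iteratedDeriv m v x| ≤ B) (p : ℝ≥0∞) : sobolevNorm m p v ≤ B :=
  eLpNorm_period_toReal_le hB (fun x _ => h x) p

lemma sobolevNorm_eq_integral {v : ℝ → ℝ} (hv : ContDiff ℝ ∞ v) (m : ℕ) {p : ℝ≥0∞} (hp0 : p ≠ 0)
    (hp : p ≠ ⊤) :
    sobolevNorm m p v = (∫ x in (0 : ℝ)..1, |iteratedDeriv m v x| ^ p.toReal) ^ p.toReal⁻¹ := by
  rw [sobolevNorm, (memLp_period (continuous_iteratedDeriv hv m) p).eLpNorm_eq_integral_rpow_norm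
    hp0 hp, intervalIntegral.integral_of_le zero_le_one, ENNReal.toReal_ofReal]
  · rfl
  · exact Real.rpow_nonneg (integral_nonneg fun x => by positivity) _

lemma sobolevNorm_one_eq_integral {v : ℝ → ℝ} (hv : ContDiff ℝ ∞ v) (m : ℕ) :
    sobolevNorm m 1 v = ∫ x in (0 : ℝ)..1, |iteratedDeriv m v x| := by
  rw [sobolevNorm_eq_integral hv m one_ne_zero ENNReal.one_ne_top]
  simp

lemma sobolevNorm_two_sq_eq_integral {v : ℝ → ℝ} (hv : ContDiff ℝ ∞ v) (m : ℕ) :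
    sobolevNorm m 2 v ^ 2 = ∫ x in (0 : ℝ)..1, iteratedDeriv m v x ^ 2 := by
  rw [sobolevNorm_eq_integral hv m two_ne_zero ENNReal.ofNat_ne_top, ← Real.rpow_natCast,
    ← Real.rpow_mul (intervalIntegral.integral_nonneg zero_le_one fun x _ => by positivity)]
  simp

lemma sobolevNorm_one_le {v : ℝ → ℝ} (hv : ContDiff ℝ ∞ v) (m : ℕ) {p : ℝ≥0∞} (hp : 1 ≤ p) :
    sobolevNorm m 1 v ≤ sobolevNorm m p v := by
  have hc := continuous_iteratedDeriv hv m
  exact ENNReal.toReal_mono (memLp_period hc p).eLpNorm_lt_top.ne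
    (eLpNorm_le_eLpNorm_of_exponent_le hp hc.aestronglyMeasurable)

lemma abs_le_sobolevNorm_top {v : ℝ → ℝ} (hv : ContDiff ℝ ∞ v) (hper : Function.Periodic v 1)
    (m : ℕ) (x : ℝ) : |iteratedDeriv m v x| ≤ sobolevNorm m ⊤ v := by
  have hc := continuous_iteratedDeriv hv m
  set K := sobolevNorm m ⊤ v with hK
  have hae : ∀ᵐ y ∂periodMeasure, |iteratedDeriv m v y| ≤ K := by
    have hfin := (memLp_period hc ⊤).eLpNorm_lt_top.ne
    filter_upwards [ae_le_eLpNormEssSup (f := iteratedDeriv m v) (μ := periodMeasure)] with y hy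
    rw [← eLpNorm_exponent_top] at hy
    have := ENNReal.toReal_mono hfin hy
    rwa [toReal_enorm] at this
  have heq : (fun y => min |iteratedDeriv m v y| K) =ᵐ[volume.restrict (Ioc (0 : ℝ) 1)]
      fun y => |iteratedDeriv m v y| := by
    filter_upwards [hae] with y hy using min_eq_left hy
  have heqOn := Measure.eqOn_of_ae_eq heq (hc.abs.min continuous_const).continuousOn
    hc.abs.continuousOn (by
      rw [interior_Ioc, closure_Ioo zero_ne_one]
      exact Ioc_subset_Icc_self)
  obtain ⟨y, hy, e⟩ := (periodic_iteratedDeriv hper m).exists_mem_Ioc one_pos x 0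
  rw [zero_add] at hy
  rw [e]
  exact min_eq_left_iff.1 (heqOn hy)

lemma IsSolution.continuousOn_sobolevNorm {f : ℝ → ℝ} {ν : ℝ} {u : ℝ → ℝ → ℝ}
    (hu : IsSolution f ν u) (m : ℕ) {p : ℝ≥0∞} (hp : 1 ≤ p) :
    ContinuousOn (fun t => sobolevNorm m p (u t)) (Ici 0) := by
  set g : ℝ → ℝ → ℝ := fun t x => iteratedDeriv m (u (max t 0)) x with hg
  have hgc : Continuous (fun z : ℝ × ℝ => g z.1 z.2) := continuous_comp_max (hu.continuousOn m)
  have hgt : ∀ t, Continuous (g t) := fun t => hgc.comp (by fun_prop : Continuous fun x => (t, x))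
  -- the norms are Lipschitz functions of `g t` in the topology of uniform convergence
  let Φ : C(ℝ, C(Icc (0 : ℝ) 1, ℝ)) := ContinuousMap.curry
    ⟨fun z : ℝ × Icc (0 : ℝ) 1 => g z.1 z.2,
      hgc.comp (continuous_fst.prodMk (continuous_subtype_val.comp continuous_snd))⟩
  have hlip : ∀ s t, (eLpNorm (g s) p periodMeasure).toReal
      ≤ (eLpNorm (g t) p periodMeasure).toReal + dist (Φ s) (Φ t) := by
    intro s t
    have h1 : eLpNorm (g s) p periodMeasure
        ≤ eLpNorm (g t) p periodMeasure + eLpNorm (g s - g t) p periodMeasure := by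
      have := eLpNorm_add_le (μ := periodMeasure) (hgt t).aestronglyMeasurable
        ((hgt s).sub (hgt t)).aestronglyMeasurable hp
      rwa [add_sub_cancel] at this
    have ft := (memLp_period (hgt t) p).eLpNorm_lt_top.ne
    have fst := (memLp_period ((hgt s).sub (hgt t)) p).eLpNorm_lt_top.ne
    have h2 := ENNReal.toReal_mono (ENNReal.add_ne_top.2 ⟨ft, fst⟩) h1
    rw [ENNReal.toReal_add ft fst] at h2
    refine h2.trans (add_le_add_right ?_ _)
    refine eLpNorm_period_toReal_le dist_nonneg (fun x hx => ?_) p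
    have := ContinuousMap.dist_apply_le_dist (f := Φ s) (g := Φ t) ⟨x, hx⟩
    rwa [Real.dist_eq] at this
  have hcont : Continuous (fun t => (eLpNorm (g t) p periodMeasure).toReal) := by
    rw [Metric.continuous_iff]
    intro t ε hε
    obtain ⟨δ, hδ, H⟩ := Metric.continuous_iff.1 Φ.continuous t ε hε
    refine ⟨δ, hδ, fun s hs => ?_⟩
    have h1 := hlip s t
    have h2 := hlip t s
    have h3 := H s hs
    rw [dist_comm (Φ t)] at h2
    rw [Real.dist_eq, abs_lt]
    constructor <;> linarith
  refine hcont.continuousOn.congr fun t ht => ?_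
  simp only [hg, max_eq_left (mem_Ici.1 ht)]
  rfl

/-! ### The exponent `γ(m, p)` -/

lemma gammaExp_zero (p : ℝ≥0∞) : gammaExp 0 p = 0 := by
  simp [gammaExp]

lemma gammaExp_of_pos {m : ℕ} {p : ℝ≥0∞} (hm : 1 ≤ m) (hp : 1 ≤ p) :
    gammaExp m p = m - p⁻¹.toReal := by
  have h1 : p⁻¹.toReal ≤ 1 := by
    have := ENNReal.toReal_mono ENNReal.one_ne_top (ENNReal.inv_le_one.2 hp)
    simpa using this
  have h2 : (1 : ℝ) ≤ m := by exact_mod_cast hm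
  exact max_eq_right (by linarith)

lemma gammaExp_nonneg (m : ℕ) (p : ℝ≥0∞) : 0 ≤ gammaExp m p := le_max_left _ _

lemma min_rpow_neg {t ν γ : ℝ} (ht : 0 < t) (hν : 0 < ν) (hγ : 0 ≤ γ) :
    min t ν ^ (-γ) = max (t ^ (-γ)) (ν ^ (-γ)) := by
  rcases le_total t ν with h | h
  · rw [min_eq_left h, max_eq_left]
    exact Real.rpow_le_rpow_of_nonpos ht h (by linarith)
  · rw [min_eq_right h, max_eq_right]
    exact Real.rpow_le_rpow_of_nonpos hν h (by linarith)

/-! ### Upper estimates of the norms -/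

lemma integral_integral_shift {g : ℝ → ℝ} (hg : Continuous g) (hper : Function.Periodic g 1)
    (μ : ℝ) : ∫ x in (0 : ℝ)..1, ∫ s in (0 : ℝ)..μ, g (x + s) = μ * ∫ x in (0 : ℝ)..1, g x := by
  rw [intervalIntegral_intervalIntegral_swap]
  · have h : ∀ s, ∫ x in (0 : ℝ)..1, g (x + s) = ∫ x in (0 : ℝ)..1, g x := by
      intro s
      rw [intervalIntegral.integral_comp_add_right, zero_add, add_comm 1 s,
        hper.intervalIntegral_add_eq s 0, zero_add]
    simp only [h, intervalIntegral.integral_const, sub_zero, smul_eq_mul]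
  · have hc : Continuous (Function.uncurry fun x s => g (x + s)) := by
      unfold Function.uncurry
      fun_prop
    exact (hc.continuousOn.integrableOn_compact
      (isCompact_uIcc.prod isCompact_uIcc)).mono_set
      (prod_mono uIoc_subset_uIcc uIoc_subset_uIcc)

/-- Pointwise interpolation between the variation of `v` over the interval `[x, x + μ]` and a
derivative of high order, when all quantities have the size prescribed by the length scale `μ`. As
the order `N` grows, the power of the variation gained in this way comes close to `1`. -/
lemma exists_abs_iteratedDeriv_rpow_le {m : ℕ} (hm : 1 ≤ m) {p : ℝ} (hp : 1 < p) {Q : ℝ}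
    (hQ : 0 < Q) : ∃ N : ℕ, ∀ B : ℝ, 0 < B → ∃ C : ℝ, 0 < C ∧ ∀ (v : ℝ → ℝ) (x μ a : ℝ),
      ContDiff ℝ ∞ v → 0 < μ → 0 < a → a ≤ Q → (∫ s in (0 : ℝ)..μ, |iteratedDeriv 1 v (x + s)|) ≤ a →
      (∀ y, |iteratedDeriv N v y| ≤ B / μ ^ N) →
      |iteratedDeriv m v x| ^ p ≤ (C / μ ^ m) ^ p * (a / Q) := by
  obtain ⟨k, hk⟩ := exists_nat_ge (m / (p - 1))
  have hk' : (m : ℝ) + k ≤ p * k := by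
    rw [div_le_iff₀ (by linarith)] at hk
    linarith
  have hN1 : 1 ≤ m + k := by omega
  refine ⟨m + k, fun B hB => ?_⟩
  obtain ⟨C, hC, hint⟩ := interpolation k m (m + k) rfl
  refine ⟨C * (Q + B), by positivity, fun v x μ a hv hμ ha haQ hva hvB => ?_⟩
  -- the subinterval has length `b μ`, where `b` balances the two terms of the interpolation
  set b : ℝ := (a / Q) ^ ((m + k : ℕ) : ℝ)⁻¹ with hb
  have hb0 : 0 < b := by positivity
  have haQ1 : a / Q ≤ 1 := (div_le_one hQ).2 haQ
  have hb1 : b ≤ 1 := Real.rpow_le_one (by positivity) haQ1 (by positivity)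
  have hbN : b ^ (m + k) = a / Q := by
    rw [hb]
    exact Real.rpow_inv_natCast_pow (by positivity) (by omega)
  have hvar : ∀ y ∈ Icc x (x + μ * b), |v y - v x| ≤ a := by
    intro y hy
    have hc := continuous_iteratedDeriv hv 1
    have e1 : v y - v x = ∫ s in (0 : ℝ)..(y - x), iteratedDeriv 1 v (x + s) := by
      rw [intervalIntegral.integral_comp_add_left]
      simp only [add_zero, add_sub_cancel]
      rw [intervalIntegral.integral_eq_sub_of_hasDerivAt (f := v)
        (fun z _ => by simpa using hasDerivAt_iteratedDeriv hv 0 z)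
        (hc.intervalIntegrable _ _)]
    have hcs : Continuous fun s => |iteratedDeriv 1 v (x + s)| := by fun_prop
    have hyx : y - x ≤ μ := by nlinarith [hy.2]
    calc |v y - v x| ≤ ∫ s in (0 : ℝ)..(y - x), |iteratedDeriv 1 v (x + s)| := by
          rw [e1]
          exact intervalIntegral.abs_integral_le_integral_abs (by linarith [hy.1])
      _ ≤ ∫ s in (0 : ℝ)..μ, |iteratedDeriv 1 v (x + s)| :=
          intervalIntegral.integral_mono_interval le_rfl (by linarith [hy.1]) hyx
            (Eventually.of_forall fun s => abs_nonneg _) (hcs.intervalIntegrable _ _)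
      _ ≤ a := hva
  have hd : ∀ j, 1 ≤ j → iteratedDeriv j (fun y => v y - v x) = iteratedDeriv j v := by
    intro j hj
    obtain ⟨i, rfl⟩ := Nat.exists_eq_add_of_le' hj
    rw [iteratedDeriv_succ', iteratedDeriv_succ']
    congr 1
    ext y
    exact deriv_sub_const _
  have h1 := hint (fun y => v y - v x) (hv.sub contDiff_const) x (μ * b) a (B / μ ^ (m + k))
    (by positivity) hvar (fun y _ => by rw [hd _ hN1]; exact hvB y) x ⟨le_rfl, by nlinarith⟩
  rw [hd m hm] at h1
  have h2 : C * (a / (μ * b) ^ m + (μ * b) ^ k * (B / μ ^ (m + k)))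
      = C * (Q + B) / μ ^ m * b ^ k := by
    have : a = Q * b ^ (m + k) := by rw [hbN]; field_simp
    rw [this]
    field_simp
    ring
  rw [h2] at h1
  calc |iteratedDeriv m v x| ^ p ≤ (C * (Q + B) / μ ^ m * b ^ k) ^ p := by gcongr
    _ = (C * (Q + B) / μ ^ m) ^ p * (b ^ k) ^ p :=
        Real.mul_rpow (by positivity) (by positivity)
    _ ≤ (C * (Q + B) / μ ^ m) ^ p * (a / Q) := by
        gcongr
        rw [← hbN, ← Real.rpow_natCast, ← Real.rpow_natCast, ← Real.rpow_mul hb0.le]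
        apply Real.rpow_le_rpow_of_exponent_ge hb0 hb1
        push_cast
        linarith

/-- Upper estimate of all norms with `m ≤ 1` or `p > 1`. -/
lemma exists_sobolevNorm_le {f : ℝ → ℝ} (hf : ContDiff ℝ ∞ f) (σ : ℝ) {D : ℝ} (hD : 0 < D) (m : ℕ)
    {p : ℝ≥0∞} (hp : 1 ≤ p) (hmp : m ≤ 1 ∨ 1 < p) :
    ∃ C : ℝ, 0 < C ∧ ∀ (ν : ℝ) (u : ℝ → ℝ → ℝ), Admissible f σ D ν u → ∀ t, 0 < t →
      sobolevNorm m p (u t) ≤ C * max (t ^ (-gammaExp m p)) (ν ^ (-gammaExp m p)) := by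
  suffices H : ∃ C : ℝ, 0 < C ∧ ∀ (ν : ℝ) (u : ℝ → ℝ → ℝ), Admissible f σ D ν u → ∀ t, 0 < t →
      sobolevNorm m p (u t) ≤ C * min t ν ^ (-gammaExp m p) by
    obtain ⟨C, hC, H⟩ := H
    refine ⟨C, hC, fun ν u h t ht => ?_⟩
    rw [← min_rpow_neg ht h.nu_pos (gammaExp_nonneg m p)]
    exact H ν u h t ht
  rcases Nat.eq_zero_or_pos m with rfl | hm
  · refine ⟨D, hD, fun ν u h t ht => ?_⟩
    rw [gammaExp_zero, neg_zero, Real.rpow_zero, mul_one]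
    refine sobolevNorm_le hD.le (fun x => ?_) p
    simpa using h.abs_le_size ht.le x
  rcases eq_or_ne p ⊤ with rfl | hptop
  · obtain ⟨C, hC, H⟩ := exists_abs_iteratedDeriv_le_scale hf σ D m
    refine ⟨C, hC, fun ν u h t ht => ?_⟩
    have hμ : 0 < min t ν := lt_min ht h.nu_pos
    rw [gammaExp_of_pos hm hp]
    simp only [ENNReal.inv_top, ENNReal.toReal_zero, sub_zero]
    rw [Real.rpow_neg hμ.le, Real.rpow_natCast, ← div_eq_mul_inv]
    exact sobolevNorm_le (by positivity) (H ν u h t ht) _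
  rcases hp.eq_or_lt with rfl | hp1
  · have hm1 : m = 1 := by
      rcases hmp with h | h
      · omega
      · exact absurd h (lt_irrefl _)
    subst hm1
    refine ⟨2 * D, by positivity, fun ν u h t ht => ?_⟩
    rw [gammaExp_of_pos le_rfl le_rfl]
    simp only [inv_one, ENNReal.toReal_one, Nat.cast_one, sub_self, neg_zero, Real.rpow_zero,
      mul_one]
    rw [sobolevNorm_one_eq_integral (h.contDiff ht.le)]
    exact h.integral_abs_deriv_le ht.le
  have hp0 : p ≠ 0 := (zero_lt_one.trans hp1).ne'
  set q := p.toReal with hq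
  have hq1 : 1 < q := by
    have := (ENNReal.toReal_lt_toReal ENNReal.one_ne_top hptop).2 hp1
    simpa using this
  have hq0 : 0 < q := by linarith
  have hQ : 0 < 2 * D + 1 := by positivity
  obtain ⟨N, HN⟩ := exists_abs_iteratedDeriv_rpow_le hm hq1 hQ
  obtain ⟨B, hB, HB⟩ := exists_abs_iteratedDeriv_le_scale hf σ D N
  obtain ⟨C, hC, HC⟩ := HN B hB
  refine ⟨C, hC, fun ν u h t ht => ?_⟩
  set μ := min t ν with hμdef
  have hμ : 0 < μ := lt_min ht h.nu_pos
  have hμ1 : μ ≤ 1 := (min_le_right _ _).trans h.nu_le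
  have hv := h.contDiff ht.le
  have hc1 : Continuous fun x => |iteratedDeriv 1 (u t) x| := (continuous_iteratedDeriv hv 1).abs
  have hper1 : Function.Periodic (fun x => |iteratedDeriv 1 (u t) x|) 1 := fun x => by
    simp only [h.solution.periodic_iteratedDeriv ht.le 1 x]
  have hL1 := h.integral_abs_deriv_le ht.le
  set I : ℝ → ℝ := fun x => ∫ s in (0 : ℝ)..μ, |iteratedDeriv 1 (u t) (x + s)| with hI
  have hIc : Continuous I := by
    apply intervalIntegral.continuous_parametric_intervalIntegral_of_continuous'
    exact hc1.comp (continuous_fst.add continuous_snd)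
  have hI0 : ∀ x, 0 ≤ I x := fun x =>
    intervalIntegral.integral_nonneg hμ.le fun s _ => abs_nonneg _
  have hI2 : ∀ x, I x ≤ 2 * D := by
    intro x
    have hcs : Continuous fun s => |iteratedDeriv 1 (u t) (x + s)| :=
      hc1.comp (continuous_const.add continuous_id)
    calc I x ≤ ∫ s in (0 : ℝ)..1, |iteratedDeriv 1 (u t) (x + s)| :=
          intervalIntegral.integral_mono_interval le_rfl hμ.le hμ1
            (Eventually.of_forall fun s => abs_nonneg _) (hcs.intervalIntegrable _ _)
      _ = ∫ s in (0 : ℝ)..1, |iteratedDeriv 1 (u t) s| := by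
          rw [intervalIntegral.integral_comp_add_left (fun s => |iteratedDeriv 1 (u t) s|),
            add_zero, hper1.intervalIntegral_add_eq x 0, zero_add]
      _ ≤ 2 * D := hL1
  -- adding `μ` to the local variation makes it positive and does not change its order of magnitude
  have hpt : ∀ x, |iteratedDeriv m (u t) x| ^ q
      ≤ (C / μ ^ m) ^ q * ((I x + μ) / (2 * D + 1)) := fun x =>
    HC (u t) x μ (I x + μ) hv hμ (by linarith [hI0 x]) (by linarith [hI2 x]) (by linarith)
      (HB ν u h t ht)
  have hint : ∫ x in (0 : ℝ)..1, |iteratedDeriv m (u t) x| ^ q ≤ (C / μ ^ m) ^ q * μ := by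
    have hcm : Continuous fun x => |iteratedDeriv m (u t) x| ^ q :=
      (continuous_iteratedDeriv hv m).abs.rpow_const fun _ => Or.inr hq0.le
    calc _ ≤ ∫ x in (0 : ℝ)..1, (C / μ ^ m) ^ q * ((I x + μ) / (2 * D + 1)) :=
          intervalIntegral.integral_mono_on zero_le_one (hcm.intervalIntegrable _ _)
            (Continuous.intervalIntegrable (by fun_prop) _ _) (fun x _ => hpt x)
      _ = (C / μ ^ m) ^ q * ((μ * (∫ x in (0 : ℝ)..1, |iteratedDeriv 1 (u t) x|) + μ)
            / (2 * D + 1)) := by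
          rw [intervalIntegral.integral_const_mul, intervalIntegral.integral_div,
            intervalIntegral.integral_add (hIc.intervalIntegrable _ _) intervalIntegrable_const,
            integral_integral_shift hc1 hper1]
          simp
      _ ≤ (C / μ ^ m) ^ q * ((μ * (2 * D) + μ) / (2 * D + 1)) := by gcongr
      _ = (C / μ ^ m) ^ q * μ := by field_simp
  rw [sobolevNorm_eq_integral hv m hp0 hptop, gammaExp_of_pos hm hp, ENNReal.toReal_inv]
  calc _ ≤ ((C / μ ^ m) ^ q * μ) ^ q⁻¹ := by
        gcongr
        exact intervalIntegral.integral_nonneg zero_le_one fun x _ => by positivity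
    _ = C * μ ^ (-((m : ℝ) - q⁻¹)) := by
        rw [Real.mul_rpow (by positivity) hμ.le, Real.rpow_rpow_inv (by positivity) hq0.ne',
          neg_sub, sub_eq_add_neg, Real.rpow_add hμ, Real.rpow_neg hμ.le, Real.rpow_natCast]
        ring

/-! ### The size of the initial condition -/

lemma sobolevNorm_zero_one_pos {v : ℝ → ℝ} (hv : ContDiff ℝ ∞ v) (hper : Function.Periodic v 1)
    (hne : ∃ x, v x ≠ 0) : 0 < sobolevNorm 0 1 v := by
  rw [sobolevNorm_one_eq_integral hv]
  simp only [iteratedDeriv_zero]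
  obtain ⟨x, hx⟩ := hne
  obtain ⟨y, hy, e⟩ := hper.exists_mem_Ico₀ one_pos x
  exact intervalIntegral.integral_pos zero_lt_one hv.continuous.abs.continuousOn
    (fun _ _ => abs_nonneg _) ⟨y, Ico_subset_Icc_self hy, abs_pos.2 (e ▸ hx)⟩

lemma dataSize_pos {v : ℝ → ℝ} (hv : ContDiff ℝ ∞ v) (hper : Function.Periodic v 1)
    (hne : ∃ x, v x ≠ 0) : 0 < dataSize v :=
  (inv_pos.2 (sobolevNorm_zero_one_pos hv hper hne)).trans_le (le_max_left _ _)

lemma inv_dataSize_le {v : ℝ → ℝ} (hv : ContDiff ℝ ∞ v) (hper : Function.Periodic v 1)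
    (hne : ∃ x, v x ≠ 0) : (dataSize v)⁻¹ ≤ sobolevNorm 0 1 v := by
  have h := sobolevNorm_zero_one_pos hv hper hne
  rw [inv_le_comm₀ (dataSize_pos hv hper hne) h]
  exact le_max_left _ _

lemma IsSolution.admissible {f : ℝ → ℝ} {σ ν : ℝ} {u : ℝ → ℝ → ℝ} (hu : IsSolution f ν u)
    (hf : ContDiff ℝ ∞ f) (hσ : 0 < σ) (hconv : ∀ y, σ ≤ iteratedDeriv 2 f y) (hν : 0 < ν)
    (hν1 : ν ≤ 1) : Admissible f σ (dataSize (u 0)) ν u where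
  smooth_flux := hf
  sigma_pos := hσ
  convex := hconv
  size_pos := dataSize_pos (hu.contDiff le_rfl) (hu.periodic 0 le_rfl) hu.nontrivial
  nu_pos := hν
  nu_le := hν1
  solution := hu
  initial x := (abs_le_sobolevNorm_top (hu.contDiff le_rfl) (hu.periodic 0 le_rfl) 1 x).trans
    (le_max_right _ _)

/-! ### The energy balance -/

namespace Admissible

variable {f : ℝ → ℝ} {σ D ν : ℝ} {u : ℝ → ℝ → ℝ} (h : Admissible f σ D ν u)
include h

lemma continuousOn_energy : ContinuousOn (fun t => ∫ x in (0 : ℝ)..1, u t x ^ 2) (Ici 0) :=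
  continuousOn_integral (g := fun z => u z.1 z.2 ^ 2) (h.solution.smooth.continuousOn.pow 2)

lemma continuousOn_dissipation :
    ContinuousOn (fun t => ∫ x in (0 : ℝ)..1, iteratedDeriv 1 (u t) x ^ 2) (Ici 0) :=
  continuousOn_integral (g := fun z => iteratedDeriv 1 (u z.1) z.2 ^ 2)
    ((h.solution.continuousOn 1).pow 2)

lemma hasDerivAt_energy {t : ℝ} (ht : 0 < t) :
    HasDerivAt (fun s => ∫ x in (0 : ℝ)..1, u s x ^ 2)
      (-(2 * ν * ∫ x in (0 : ℝ)..1, iteratedDeriv 1 (u t) x ^ 2)) t := by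
  have hcu := h.contDiff ht.le
  have hUc := h.solution.smooth.continuousOn
  have hf1 := continuous_iteratedDeriv h.smooth_flux 1
  have h1 := hasDerivAt_integral (g := fun z => u z.1 z.2 ^ 2)
    (g' := fun z => 2 * u z.1 z.2 * (ν * iteratedDeriv 2 (u z.1) z.2
      - iteratedDeriv 1 f (u z.1 z.2) * iteratedDeriv 1 (u z.1) z.2))
    (hUc.pow 2)
    ((continuousOn_const.mul hUc).mul ((continuousOn_const.mul (h.solution.continuousOn 2)).sub
      ((hf1.comp_continuousOn hUc).mul (h.solution.continuousOn 1))))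
    (fun t ht x => ((h.hasDerivAt_t ht x).fun_pow 2).congr_deriv (by push_cast; ring)) ht
  refine h1.congr_deriv ?_
  have hu0 := hcu.continuous
  have hu1 := continuous_iteratedDeriv hcu 1
  have hu2 := continuous_iteratedDeriv hcu 2
  have hfu : Continuous fun x => iteratedDeriv 1 f (u t x) := hf1.comp hu0
  -- the flux term is the derivative of a function of `u`, built with a primitive of `f`
  have hΦ : ∀ y, HasDerivAt (fun z => ∫ s in (0 : ℝ)..z, f s) (f y) y := fun y =>
    intervalIntegral.integral_hasDerivAt_right (h.smooth_flux.continuous.intervalIntegrable _ _)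
      (h.smooth_flux.continuous.stronglyMeasurableAtFilter _ _) h.smooth_flux.continuous.continuousAt
  have h2 := integral_deriv_periodic
    (g := fun x => 2 * ν * (u t x * iteratedDeriv 1 (u t) x)
      + (2 * (∫ s in (0 : ℝ)..(u t x), f s) - 2 * (u t x * (f ∘ u t) x)))
    (g' := fun x => 2 * u t x * (ν * iteratedDeriv 2 (u t) x
      - iteratedDeriv 1 f (u t x) * iteratedDeriv 1 (u t) x)
      + 2 * ν * iteratedDeriv 1 (u t) x ^ 2)
    (fun x => by
      simp only [Function.comp_apply, h.solution.periodic_iteratedDeriv ht.le 1 x,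
        h.solution.periodic t ht.le x])
    (fun x => by
      have hux := h.hasDerivAt_x ht.le x
      refine (((hux.mul (h.solution.hasDerivAt_space ht.le 1 x)).const_mul (2 * ν)).add
        ((((hΦ (u t x)).comp x hux).const_mul 2).sub
          ((hux.mul (hasDerivAt_comp_flux h.smooth_flux hcu x)).const_mul 2))).congr_deriv ?_
      simp only [Function.comp_apply]
      ring)
    (by fun_prop)
  rw [intervalIntegral.integral_add (Continuous.intervalIntegrable (by fun_prop) _ _)
    (Continuous.intervalIntegrable (by fun_prop) _ _), intervalIntegral.integral_const_mul] at h2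
  linarith

lemma energy_le {t B : ℝ} (ht : 0 ≤ t) (hB : ∀ x, |u t x| ≤ B) :
    ∫ x in (0 : ℝ)..1, u t x ^ 2 ≤ B ^ 2 := by
  have hc := (h.contDiff ht).continuous
  calc ∫ x in (0 : ℝ)..1, u t x ^ 2 ≤ ∫ _x in (0 : ℝ)..1, B ^ 2 :=
        intervalIntegral.integral_mono_on zero_le_one ((hc.pow 2).intervalIntegrable _ _)
          intervalIntegrable_const (fun x _ => by
            rw [← sq_abs]
            exact pow_le_pow_left₀ (abs_nonneg _) (hB x) 2)
    _ = B ^ 2 := by simp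

/-- If the dissipation rate is at most `K`, the energy cannot decay faster than `2 K t`. -/
lemma energy_ge {K : ℝ}
    (hK : ∀ t, 0 ≤ t → ν * ∫ x in (0 : ℝ)..1, iteratedDeriv 1 (u t) x ^ 2 ≤ K) {t : ℝ}
    (ht : 0 ≤ t) :
    (∫ x in (0 : ℝ)..1, u 0 x ^ 2) - 2 * K * t ≤ ∫ x in (0 : ℝ)..1, u t x ^ 2 := by
  rcases ht.eq_or_lt with rfl | ht
  · simp
  obtain ⟨s, hs, e⟩ := exists_hasDerivAt_eq_slope (fun s => ∫ x in (0 : ℝ)..1, u s x ^ 2) _ ht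
    (h.continuousOn_energy.mono Icc_subset_Ici_self) (fun s hs => h.hasDerivAt_energy hs.1)
  rw [sub_zero, eq_div_iff ht.ne'] at e
  have := hK s hs.1.le
  have h2 : ν * (∫ x in (0 : ℝ)..1, iteratedDeriv 1 (u s) x ^ 2) * t ≤ K * t := by gcongr
  linarith

lemma integral_dissipation {a b : ℝ} (ha : 0 < a) (hab : a ≤ b) :
    2 * (ν * ∫ t in a..b, ∫ x in (0 : ℝ)..1, iteratedDeriv 1 (u t) x ^ 2)
      = (∫ x in (0 : ℝ)..1, u a x ^ 2) - ∫ x in (0 : ℝ)..1, u b x ^ 2 := by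
  have hsub : uIcc a b ⊆ Ici 0 := by
    rw [uIcc_of_le hab]
    exact fun t ht => ha.le.trans ht.1
  have h1 := intervalIntegral.integral_eq_sub_of_hasDerivAt
    (fun t ht => h.hasDerivAt_energy (t := t) (by
      rw [uIcc_of_le hab] at ht
      exact ha.trans_le ht.1))
    ((continuousOn_const.mul (h.continuousOn_dissipation.mono hsub)).neg.intervalIntegrable)
  rw [intervalIntegral.integral_neg, intervalIntegral.integral_const_mul] at h1
  linarith

end Admissible

/-! ### Lower estimates at a fixed time -/

lemma exists_abs_deriv_ge {g : ℝ → ℝ} {c D : ℝ} (hg : Continuous g) (hD : 0 < D) (hc : 0 < c)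
    (h1 : ∫ x in (0 : ℝ)..1, |g x| ≤ 2 * D) (h2 : c ≤ ∫ x in (0 : ℝ)..1, g x ^ 2) :
    ∃ x, c / (4 * D) ≤ |g x| := by
  by_contra! hlt
  have : ∫ x in (0 : ℝ)..1, g x ^ 2 ≤ c / (4 * D) * ∫ x in (0 : ℝ)..1, |g x| := by
    rw [← intervalIntegral.integral_const_mul]
    refine intervalIntegral.integral_mono_on zero_le_one ((hg.pow 2).intervalIntegrable _ _)
      (Continuous.intervalIntegrable (by fun_prop) _ _) (fun x _ => ?_)
    rw [← sq_abs, sq]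
    exact mul_le_mul_of_nonneg_right (hlt x).le (abs_nonneg _)
  have h3 : c / (4 * D) * (∫ x in (0 : ℝ)..1, |g x|) ≤ c / (4 * D) * (2 * D) := by gcongr
  have h4 : c / (4 * D) * (2 * D) = c / 2 := by field_simp; norm_num
  linarith

/-- If `|v|` is bounded and `|v'|` reaches the size `ν⁻¹`, then `|v⁽ᵐ⁾|` reaches the size `ν⁻ᵐ`. -/
lemma exists_abs_iteratedDeriv_ge {m : ℕ} (hm : 1 ≤ m) {c D : ℝ} (hc : 0 < c) (hD : 0 < D) :
    ∃ a : ℝ, 0 < a ∧ ∀ (v : ℝ → ℝ) (ν : ℝ), ContDiff ℝ ∞ v → 0 < ν → (∀ x, |v x| ≤ D) →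
      (∃ x, c / ν ≤ |iteratedDeriv 1 v x|) → ∃ x, a / ν ^ m ≤ |iteratedDeriv m v x| := by
  obtain ⟨k, rfl⟩ := Nat.exists_eq_add_of_le hm
  obtain ⟨C, hC, hint⟩ := interpolation k 1 (1 + k) rfl
  -- interpolation over an interval of length `A ν`
  set A : ℝ := 4 * C * D / c with hA
  have hA0 : 0 < A := by positivity
  refine ⟨c / (4 * C * A ^ k), by positivity, fun v ν hv hν hvD hx => ?_⟩
  obtain ⟨x, hx⟩ := hx
  by_contra! hlt
  have h1 := hint v hv x (A * ν) D _ (by positivity) (fun y _ => hvD y) (fun y _ => (hlt y).le) x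
    ⟨le_rfl, by linarith [mul_pos hA0 hν]⟩
  have h2 : C * (D / (A * ν) ^ 1 + (A * ν) ^ k * (c / (4 * C * A ^ k) / ν ^ (1 + k)))
      = c / 2 / ν := by
    rw [pow_one]
    have e1 : D / (A * ν) = c / (4 * C * ν) := by
      rw [hA]
      field_simp
    rw [e1]
    field_simp
    ring
  have h3 : c / 2 / ν < c / ν := by
    apply div_lt_div_of_pos_right _ hν
    linarith
  linarith

/-- A function that reaches the size `S` and whose derivative is at most `S / (2 ℓ)` has an `L_p`
norm of at least `(S / 2) ℓ^(1/p)`. -/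
lemma sobolevNorm_ge {v : ℝ → ℝ} (hv : ContDiff ℝ ∞ v) (hper : Function.Periodic v 1) {m : ℕ}
    {p : ℝ≥0∞} (hp : 1 ≤ p) {S ℓ x₀ : ℝ} (hS : 0 < S) (hℓ : 0 < ℓ) (hℓ1 : ℓ ≤ 1)
    (hx₀ : S ≤ |iteratedDeriv m v x₀|) (hd : ∀ x, |iteratedDeriv (m + 1) v x| ≤ S / (2 * ℓ)) :
    S / 2 * ℓ ^ p⁻¹.toReal ≤ sobolevNorm m p v := by
  rcases eq_or_ne p ⊤ with rfl | hptop
  · simp only [ENNReal.inv_top, ENNReal.toReal_zero, Real.rpow_zero, mul_one]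
    linarith [abs_le_sobolevNorm_top hv hper m x₀]
  have hp0 : p ≠ 0 := (zero_lt_one.trans_le hp).ne'
  set q := p.toReal with hq
  have hq0 : 0 < q := ENNReal.toReal_pos hp0 hptop
  have hlow : ∀ x ∈ Icc x₀ (x₀ + ℓ), S / 2 ≤ |iteratedDeriv m v x| := by
    intro x hx
    have h1 := abs_sub_le_of_hasDerivAt (a := x₀) (b := x₀ + ℓ) (hasDerivAt_iteratedDeriv hv m)
      (fun y _ => hd y) ⟨le_rfl, by linarith⟩ hx
    have h2 : S / (2 * ℓ) * |x - x₀| ≤ S / (2 * ℓ) * ℓ := by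
      rw [abs_of_nonneg (by linarith [hx.1])]
      gcongr
      linarith [hx.2]
    have h3 : S / (2 * ℓ) * ℓ = S / 2 := by field_simp
    have h4 := abs_sub_abs_le_abs_sub (iteratedDeriv m v x₀) (iteratedDeriv m v x)
    rw [abs_sub_comm] at h4
    linarith
  have hc : Continuous fun x => |iteratedDeriv m v x| ^ q :=
    (continuous_iteratedDeriv hv m).abs.rpow_const fun _ => Or.inr hq0.le
  have hperq : Function.Periodic (fun x => |iteratedDeriv m v x| ^ q) 1 := fun x => by
    simp only [periodic_iteratedDeriv hper m x]
  have hint : (S / 2) ^ q * ℓ ≤ ∫ x in (0 : ℝ)..1, |iteratedDeriv m v x| ^ q := by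
    have e := hperq.intervalIntegral_add_eq 0 x₀
    rw [zero_add] at e
    rw [e]
    calc (S / 2) ^ q * ℓ = ∫ _x in x₀..(x₀ + ℓ), (S / 2) ^ q := by
          rw [intervalIntegral.integral_const, add_sub_cancel_left, smul_eq_mul, mul_comm]
      _ ≤ ∫ x in x₀..(x₀ + ℓ), |iteratedDeriv m v x| ^ q :=
          intervalIntegral.integral_mono_on (by linarith) intervalIntegrable_const
            (hc.intervalIntegrable _ _) (fun x hx => by
              have := hlow x hx
              gcongr)
      _ ≤ _ := intervalIntegral.integral_mono_interval le_rfl (by linarith) (by linarith)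
          (Eventually.of_forall fun s => by positivity) (hc.intervalIntegrable _ _)
  rw [sobolevNorm_eq_integral hv m hp0 hptop, ENNReal.toReal_inv, ← hq]
  calc S / 2 * ℓ ^ q⁻¹ = ((S / 2) ^ q * ℓ) ^ q⁻¹ := by
        rw [Real.mul_rpow (by positivity) hℓ.le, Real.rpow_rpow_inv (by positivity) hq0.ne']
    _ ≤ _ := by gcongr

/-- At times when the dissipation rate `ν |u_x|_2 ^ 2` is not small, all norms with `m ≥ 1` are at
least of the order `ν ^ (-γ)`. -/
lemma exists_sobolevNorm_ge_of_dissipation {f : ℝ → ℝ} (hf : ContDiff ℝ ∞ f) (σ : ℝ) {D : ℝ}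
    (hD : 0 < D) {m : ℕ} (hm : 1 ≤ m) {p : ℝ≥0∞} (hp : 1 ≤ p) {c T : ℝ} (hc : 0 < c) (hT : 0 < T) :
    ∃ a : ℝ, 0 < a ∧ ∀ (ν : ℝ) (u : ℝ → ℝ → ℝ), Admissible f σ D ν u → ∀ t, T ≤ t →
      c ≤ ν * (∫ x in (0 : ℝ)..1, iteratedDeriv 1 (u t) x ^ 2) →
      a * ν ^ (-gammaExp m p) ≤ sobolevNorm m p (u t) := by
  obtain ⟨a, ha, Ha⟩ := exists_abs_iteratedDeriv_ge hm (c := c / (4 * D)) (by positivity) hD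
  obtain ⟨B₀, hB₀, HB⟩ := exists_abs_iteratedDeriv_le_scale hf σ D (m + 1)
  set τ : ℝ := min T 1 with hτ
  have hτ0 : 0 < τ := lt_min hT one_pos
  set B : ℝ := B₀ / τ ^ (m + 1) + a with hB
  have hB0 : 0 < B := by positivity
  refine ⟨a / 2 * (a / (2 * B)) ^ p⁻¹.toReal, by positivity, fun ν u h t ht hdis => ?_⟩
  have hν := h.nu_pos
  have ht0 : 0 < t := hT.trans_le ht
  have hv := h.contDiff ht0.le
  obtain ⟨x₀, hx₀⟩ := Ha (u t) ν hv hν (h.abs_le_size ht0.le) (by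
    obtain ⟨x, hx⟩ := exists_abs_deriv_ge (continuous_iteratedDeriv hv 1) hD
      (by positivity : 0 < c / ν) (h.integral_abs_deriv_le ht0.le)
      (by rw [div_le_iff₀ hν]; linarith)
    refine ⟨x, le_of_eq_of_le ?_ hx⟩
    field_simp)
  have hmin : τ * ν ≤ min t ν := by
    have h1 : τ ≤ T := min_le_left _ _
    have h2 : τ ≤ 1 := min_le_right _ _
    refine le_min ?_ ?_
    · nlinarith [h.nu_le]
    · nlinarith
  have hd : ∀ x, |iteratedDeriv (m + 1) (u t) x| ≤ a / ν ^ m / (2 * (a / (2 * B) * ν)) := by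
    intro x
    calc _ ≤ B₀ / min t ν ^ (m + 1) := HB ν u h t ht0 x
      _ ≤ B₀ / (τ * ν) ^ (m + 1) := by gcongr
      _ = B₀ / τ ^ (m + 1) / ν ^ (m + 1) := by rw [mul_pow]; field_simp
      _ ≤ B / ν ^ (m + 1) := by
          gcongr
          linarith
      _ = _ := by
          field_simp
          ring
  have hℓ1 : a / (2 * B) * ν ≤ 1 := by
    have h1 : a / (2 * B) ≤ 1 := by
      rw [div_le_one (by positivity)]
      have : 0 < B₀ / τ ^ (m + 1) := by positivity
      linarith
    have h2 : 0 < a / (2 * B) := by positivity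
    nlinarith [h.nu_le]
  have key := sobolevNorm_ge hv (h.solution.periodic t ht0.le) hp (by positivity) (by positivity)
    hℓ1 hx₀ hd
  refine le_of_eq_of_le ?_ key
  rw [gammaExp_of_pos hm hp, neg_sub, sub_eq_add_neg, Real.rpow_add hν, Real.rpow_neg hν.le,
    Real.rpow_natCast, Real.mul_rpow (by positivity) hν.le]
  field_simp

/-! ### Time averages -/

lemma timeOne_pos {D K : ℝ} (hD : 0 < D) (hK : 0 < K) : 0 < timeOne D K := by
  unfold timeOne
  positivity

lemma timeOne_lt_timeTwo {σ D K : ℝ} (hD : 0 < D) (hK : 0 < K) : timeOne D K < timeTwo σ D K := by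
  have := timeOne_pos hD hK
  exact lt_of_lt_of_le (by linarith) (le_max_left _ _)

/-- A function that is at least `a` wherever an auxiliary function `g ≤ 1` of positive integral is
positive has moments of order `α`, for every `α > 0`, bounded below in terms of `a`. -/
lemma le_timeAverage_rpow {σ D K α a κ : ℝ} (hT : timeOne D K < timeTwo σ D K) (hα : 0 < α)
    (ha : 0 < a) (hκ : 0 < κ) {A g : ℝ → ℝ}
    (hA : ContinuousOn A (Icc (timeOne D K) (timeTwo σ D K)))
    (hA0 : ∀ t ∈ Icc (timeOne D K) (timeTwo σ D K), 0 ≤ A t)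
    (hg : ContinuousOn g (Icc (timeOne D K) (timeTwo σ D K)))
    (hg1 : ∀ t ∈ Icc (timeOne D K) (timeTwo σ D K), g t ≤ 1)
    (hgint : κ ≤ ∫ t in (timeOne D K)..(timeTwo σ D K), g t)
    (hAa : ∀ t ∈ Icc (timeOne D K) (timeTwo σ D K), 0 < g t → a ≤ A t) :
    (κ / (timeTwo σ D K - timeOne D K)) ^ (1 / α) * a
      ≤ timeAverage σ D K (fun t => A t ^ α) ^ (1 / α) := by
  have hpos : 0 < timeTwo σ D K - timeOne D K := sub_pos.2 hT
  have h1 : a ^ α * κ ≤ ∫ t in (timeOne D K)..(timeTwo σ D K), A t ^ α := by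
    calc a ^ α * κ ≤ a ^ α * ∫ t in (timeOne D K)..(timeTwo σ D K), g t := by gcongr
      _ = ∫ t in (timeOne D K)..(timeTwo σ D K), a ^ α * g t := by
          rw [intervalIntegral.integral_const_mul]
      _ ≤ _ := by
          refine intervalIntegral.integral_mono_on hT.le ?_ ?_ (fun t ht => ?_)
          · exact (continuousOn_const.mul hg).intervalIntegrable_of_Icc hT.le
          · exact (hA.rpow_const fun _ _ => Or.inr hα.le).intervalIntegrable_of_Icc hT.le
          · have hp : 0 ≤ a ^ α := by positivity
            rcases le_or_gt (g t) 0 with h0 | h0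
            · exact (mul_nonpos_of_nonneg_of_nonpos hp h0).trans (Real.rpow_nonneg (hA0 t ht) _)
            · calc a ^ α * g t ≤ a ^ α * 1 := by
                    gcongr
                    exact hg1 t ht
                _ ≤ A t ^ α := by
                    rw [mul_one]
                    exact Real.rpow_le_rpow ha.le (hAa t ht h0) hα.le
  have h2 : κ / (timeTwo σ D K - timeOne D K) * a ^ α ≤ timeAverage σ D K (fun t => A t ^ α) := by
    unfold timeAverage
    rw [one_div, inv_mul_eq_div, div_mul_eq_mul_div, mul_comm κ]
    gcongr
  calc _ = (κ / (timeTwo σ D K - timeOne D K) * a ^ α) ^ (1 / α) := by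
        rw [Real.mul_rpow (by positivity) (by positivity), one_div, Real.rpow_rpow_inv ha.le hα.ne']
    _ ≤ _ := by gcongr

lemma timeAverage_rpow_le {σ D K α a : ℝ} (hT : timeOne D K < timeTwo σ D K) (hα : 0 < α)
    (ha : 0 ≤ a) {A : ℝ → ℝ} (hA : ContinuousOn A (Icc (timeOne D K) (timeTwo σ D K)))
    (hA0 : ∀ t ∈ Icc (timeOne D K) (timeTwo σ D K), 0 ≤ A t)
    (hAa : ∀ t ∈ Icc (timeOne D K) (timeTwo σ D K), A t ≤ a) :
    timeAverage σ D K (fun t => A t ^ α) ^ (1 / α) ≤ a := by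
  have hpos : 0 < timeTwo σ D K - timeOne D K := sub_pos.2 hT
  have h1 : timeAverage σ D K (fun t => A t ^ α) ≤ a ^ α := by
    unfold timeAverage
    rw [one_div, inv_mul_le_iff₀ hpos]
    calc _ ≤ ∫ _t in (timeOne D K)..(timeTwo σ D K), a ^ α :=
          intervalIntegral.integral_mono_on hT.le
            ((hA.rpow_const fun _ _ => Or.inr hα.le).intervalIntegrable_of_Icc hT.le)
            intervalIntegrable_const
            (fun t ht => Real.rpow_le_rpow (hA0 t ht) (hAa t ht) hα.le)
      _ = _ := by simp
  have h0 : 0 ≤ timeAverage σ D K (fun t => A t ^ α) :=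
    mul_nonneg (by positivity)
      (intervalIntegral.integral_nonneg hT.le fun t ht => Real.rpow_nonneg (hA0 t ht) _)
  calc _ ≤ (a ^ α) ^ (1 / α) := by gcongr
    _ = a := by rw [one_div, Real.rpow_rpow_inv ha hα.ne']

/-- A constant `K` with `|u(t)|_{1,2} ^ 2 ≤ K ν⁻¹` exists: interpolate between the bounds for `|u_x|_1`
and `|u_x|_∞`. -/
lemma exists_isEnergyConst {f : ℝ → ℝ} {σ : ℝ} (hf : ContDiff ℝ ∞ f) (hσ : 0 < σ)
    (hconv : ∀ y, σ ≤ iteratedDeriv 2 f y) (D : ℝ) : ∃ K, IsEnergyConst f D K := by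
  obtain ⟨F, hF, hFf⟩ := exists_bound_derivatives hf D 2
  refine ⟨(2 * D ^ 2 * F + 2 * |D|) * (2 * |D|) + 1, by positivity, ?_⟩
  rintro ν u hν hν1 hu rfl t ht
  have h := hu.admissible hf hσ hconv hν hν1
  have hD := h.size_pos
  set D := dataSize (u 0)
  rw [abs_of_pos hD]
  have hc := continuous_iteratedDeriv (h.contDiff ht) 1
  rw [sobolevNorm_two_sq_eq_integral (h.contDiff ht), ← div_eq_mul_inv]
  have hB : 0 ≤ (2 * D ^ 2 * F + 2 * D) / ν := by positivity
  calc ∫ x in (0 : ℝ)..1, iteratedDeriv 1 (u t) x ^ 2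
      ≤ ∫ x in (0 : ℝ)..1, (2 * D ^ 2 * F + 2 * D) / ν * |iteratedDeriv 1 (u t) x| := by
        refine intervalIntegral.integral_mono_on zero_le_one ((hc.pow 2).intervalIntegrable _ _)
          (Continuous.intervalIntegrable (by fun_prop) _ _) (fun x _ => ?_)
        rw [← sq_abs, sq]
        gcongr
        exact h.abs_deriv_le hF.le (fun y hy => (abs_le.1 (hFf 2 le_rfl y hy)).2) ht x
    _ ≤ (2 * D ^ 2 * F + 2 * D) / ν * (2 * D) := by
        rw [intervalIntegral.integral_const_mul]
        exact mul_le_mul_of_nonneg_left (h.integral_abs_deriv_le ht) hB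
    _ = ((2 * D ^ 2 * F + 2 * D) * (2 * D)) / ν := by ring
    _ ≤ _ := by
        gcongr
        linarith

section Averages

variable {f : ℝ → ℝ} {σ K ν : ℝ} {u : ℝ → ℝ → ℝ}

lemma IsEnergyConst.dissipation_le (hK : IsEnergyConst f (dataSize (u 0)) K) (hν : 0 < ν)
    (hν1 : ν ≤ 1) (hu : IsSolution f ν u) (t : ℝ) (ht : 0 ≤ t) :
    ν * ∫ x in (0 : ℝ)..1, iteratedDeriv 1 (u t) x ^ 2 ≤ K := by
  have h := hK.2 ν u hν hν1 hu rfl t ht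
  rw [sobolevNorm_two_sq_eq_integral (hu.contDiff ht), ← div_eq_mul_inv, le_div_iff₀ hν] at h
  linarith

lemma IsSolution.initial_energy_ge (hu : IsSolution f ν u) :
    (dataSize (u 0) ^ 2)⁻¹ ≤ ∫ x in (0 : ℝ)..1, u 0 x ^ 2 := by
  have hv := hu.contDiff le_rfl
  have hper := hu.periodic 0 le_rfl
  have h1 := (inv_dataSize_le hv hper hu.nontrivial).trans
    (sobolevNorm_one_le hv 0 (p := 2) one_le_two)
  have h2 := pow_le_pow_left₀ (inv_pos.2 (dataSize_pos hv hper hu.nontrivial)).le h1 2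
  rw [sobolevNorm_two_sq_eq_integral hv, inv_pow] at h2
  simpa using h2

/-- Up to time `3 T₁ / 2` at least a quarter of the lower bound `D⁻²` for the initial energy is
left. -/
lemma Admissible.energy_ge_of_le (h : Admissible f σ (dataSize (u 0)) ν u)
    (hK : IsEnergyConst f (dataSize (u 0)) K) {t : ℝ} (ht : 0 ≤ t)
    (htT : t ≤ 3 / 2 * timeOne (dataSize (u 0)) K) :
    (dataSize (u 0) ^ 2)⁻¹ / 4 ≤ ∫ x in (0 : ℝ)..1, u t x ^ 2 := by
  have h1 := h.energy_ge (hK.dissipation_le h.nu_pos h.nu_le h.solution) ht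
  have h2 := h.solution.initial_energy_ge
  have hK0 := hK.1
  have h3 : 2 * K * t ≤ 2 * K * (3 / 2 * timeOne (dataSize (u 0)) K) := by gcongr
  have h4 : 2 * K * (3 / 2 * timeOne (dataSize (u 0)) K) = 3 / 4 * (dataSize (u 0) ^ 2)⁻¹ := by
    unfold timeOne
    field_simp
  linarith

/-- Between `T₁` and `T₂` a fixed amount of energy is dissipated: at time `T₁` at least half of `D⁻²` is
left, at time `T₂` at most a quarter by Oleinik's estimate. -/
lemma Admissible.integral_dissipation_ge (h : Admissible f σ (dataSize (u 0)) ν u)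
    (hK : IsEnergyConst f (dataSize (u 0)) K) :
    (dataSize (u 0) ^ 2)⁻¹ / 8 ≤ ∫ t in (timeOne (dataSize (u 0)) K)..
      (timeTwo σ (dataSize (u 0)) K),
      ν * ∫ x in (0 : ℝ)..1, iteratedDeriv 1 (u t) x ^ 2 := by
  have h2 := h.solution.initial_energy_ge
  have hK0 := hK.1
  have hD := h.size_pos
  have hdis := hK.dissipation_le h.nu_pos h.nu_le h.solution
  set D := dataSize (u 0)
  have hσ := h.sigma_pos
  have hT1 := timeOne_pos hD hK0
  have hT := timeOne_lt_timeTwo (σ := σ) hD hK0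
  have h1 := h.energy_ge hdis hT1.le
  have h4 : 2 * K * timeOne D K = (D ^ 2)⁻¹ / 2 := by
    unfold timeOne
    field_simp
    norm_num
  have h5 : ∫ x in (0 : ℝ)..1, u (timeTwo σ D K) x ^ 2 ≤ (1 / (2 * D)) ^ 2 := by
    refine h.energy_le (hT1.trans hT).le fun x => ?_
    refine (h.abs_le_inv_time (hT1.trans hT) x).trans ?_
    have h6 : 2 * D * σ⁻¹ ≤ timeTwo σ D K := le_max_right _ _
    have h7 : 2 * D ≤ σ * timeTwo σ D K := by
      rw [← div_eq_mul_inv, div_le_iff₀ hσ] at h6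
      linarith
    gcongr
  have h8 : (1 / (2 * D)) ^ 2 = (D ^ 2)⁻¹ / 4 := by
    field_simp
    norm_num
  have h9 := h.integral_dissipation hT1 hT.le
  rw [intervalIntegral.integral_const_mul]
  linarith

end Averages

/-- Lower estimate of the moments of all norms. -/
lemma exists_le_timeAverage {f : ℝ → ℝ} {σ : ℝ} (hf : ContDiff ℝ ∞ f) (hσ : 0 < σ)
    (hconv : ∀ y, σ ≤ iteratedDeriv 2 f y) {D : ℝ} (hD : 0 < D) {K : ℝ} (hK : IsEnergyConst f D K)
    (m : ℕ) {p : ℝ≥0∞} (hp : 1 ≤ p) {α : ℝ} (hα : 0 < α) :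
    ∃ c : ℝ, 0 < c ∧ ∀ (ν : ℝ) (u : ℝ → ℝ → ℝ), 0 < ν → ν ≤ 1 → IsSolution f ν u →
      dataSize (u 0) = D → c * ν ^ (-gammaExp m p) ≤
        timeAverage σ D K (fun t => sobolevNorm m p (u t) ^ α) ^ (1 / α) := by
  have hK0 := hK.1
  have hT1 := timeOne_pos hD hK0
  have hT := timeOne_lt_timeTwo (σ := σ) hD hK0
  have hΔ : 0 < timeTwo σ D K - timeOne D K := sub_pos.2 hT
  have hsub : Icc (timeOne D K) (timeTwo σ D K) ⊆ Ici 0 := fun t ht => hT1.le.trans ht.1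
  rcases Nat.eq_zero_or_pos m with rfl | hm
  · -- for `m = 0` the energy is used, which is not small on `[T₁, 3 T₁ / 2]`
    set e : ℝ := timeOne D K * (D ^ 2)⁻¹ / (16 * (timeTwo σ D K - timeOne D K)) with he
    have he0 : 0 < e := by positivity
    have heΔ : e * (timeTwo σ D K - timeOne D K) = timeOne D K * (D ^ 2)⁻¹ / 16 := by
      rw [he]
      field_simp
    set κ : ℝ := timeOne D K * (D ^ 2)⁻¹ / 16 / D ^ 2 with hκ
    have hκ0 : 0 < κ := by positivity
    refine ⟨(κ / (timeTwo σ D K - timeOne D K)) ^ (1 / α) * (e / D), by positivity,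
      fun ν u hν hν1 hu hDu => ?_⟩
    subst hDu
    have h := hu.admissible hf hσ hconv hν hν1
    set D := dataSize (u 0)
    rw [gammaExp_zero, neg_zero, Real.rpow_zero, mul_one]
    have hEc := h.continuousOn_energy.mono hsub
    refine le_timeAverage_rpow hT hα (by positivity) hκ0
      (A := fun t => sobolevNorm 0 p (u t))
      (g := fun t => ((∫ x in (0 : ℝ)..1, u t x ^ 2) - e) / D ^ 2)
      ((hu.continuousOn_sobolevNorm 0 hp).mono hsub) (fun _ _ => sobolevNorm_nonneg _ _ _)
      ((hEc.sub continuousOn_const).div_const _) ?_ ?_ ?_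
    · intro t ht
      rw [div_le_one (by positivity)]
      linarith [h.energy_le (hsub ht) (h.abs_le_size (hsub ht))]
    · have hmid : 3 / 2 * timeOne D K ≤ timeTwo σ D K := le_max_left _ _
      have hle : timeOne D K ≤ 3 / 2 * timeOne D K := by linarith
      have hEi := hEc.intervalIntegrable_of_Icc (μ := volume) hT.le
      have h1 : timeOne D K * (D ^ 2)⁻¹ / 8
          ≤ ∫ t in (timeOne D K)..(timeTwo σ D K), ∫ x in (0 : ℝ)..1, u t x ^ 2 := by
        calc timeOne D K * (D ^ 2)⁻¹ / 8
            = ∫ _t in (timeOne D K)..(3 / 2 * timeOne D K), (D ^ 2)⁻¹ / 4 := by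
              rw [intervalIntegral.integral_const, smul_eq_mul]
              ring
          _ ≤ ∫ t in (timeOne D K)..(3 / 2 * timeOne D K), ∫ x in (0 : ℝ)..1, u t x ^ 2 := by
              refine intervalIntegral.integral_mono_on hle intervalIntegrable_const
                ((hEc.mono (Icc_subset_Icc_right hmid)).intervalIntegrable_of_Icc hle)
                (fun t ht => h.energy_ge_of_le hK (hT1.le.trans ht.1) ht.2)
          _ ≤ _ := intervalIntegral.integral_mono_interval le_rfl hle hmid
              (Eventually.of_forall fun t =>
                intervalIntegral.integral_nonneg zero_le_one fun x _ => sq_nonneg _) hEi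
      rw [intervalIntegral.integral_div, intervalIntegral.integral_sub hEi intervalIntegrable_const,
        intervalIntegral.integral_const, smul_eq_mul, mul_comm _ e, heΔ, hκ]
      gcongr
      linarith
    · intro t ht hpos
      have ht0 : 0 ≤ t := hsub ht
      have hv := h.contDiff ht0
      have h1 : e < ∫ x in (0 : ℝ)..1, u t x ^ 2 := by
        have := (div_pos_iff_of_pos_right (by positivity : 0 < D ^ 2)).1 hpos
        linarith
      have h2 : ∫ x in (0 : ℝ)..1, u t x ^ 2 ≤ D * ∫ x in (0 : ℝ)..1, |u t x| := by
        rw [← intervalIntegral.integral_const_mul]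
        refine intervalIntegral.integral_mono_on zero_le_one
          ((hv.continuous.pow 2).intervalIntegrable _ _)
          ((continuous_const.mul hv.continuous.abs).intervalIntegrable _ _) (fun x _ => ?_)
        rw [← sq_abs, sq]
        gcongr
        exact h.abs_le_size ht0 x
      have h3 := sobolevNorm_one_le hv 0 hp
      rw [sobolevNorm_one_eq_integral hv] at h3
      simp only [iteratedDeriv_zero] at h3
      refine le_trans ?_ h3
      rw [div_le_iff₀ hD]
      linarith
  · set e : ℝ := (D ^ 2)⁻¹ / (16 * (timeTwo σ D K - timeOne D K)) with he
    have he0 : 0 < e := by positivity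
    have heΔ : e * (timeTwo σ D K - timeOne D K) = (D ^ 2)⁻¹ / 16 := by
      rw [he]
      field_simp
    set κ : ℝ := (D ^ 2)⁻¹ / 16 / K with hκ
    have hκ0 : 0 < κ := by positivity
    obtain ⟨a, ha, Ha⟩ := exists_sobolevNorm_ge_of_dissipation hf σ hD hm hp he0 hT1
    refine ⟨(κ / (timeTwo σ D K - timeOne D K)) ^ (1 / α) * a, by positivity,
      fun ν u hν hν1 hu hDu => ?_⟩
    subst hDu
    have h := hu.admissible hf hσ hconv hν hν1
    have hint := h.integral_dissipation_ge hK
    have hdis := hK.dissipation_le hν hν1 hu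
    set D := dataSize (u 0)
    have hGc : ContinuousOn (fun t => ν * ∫ x in (0 : ℝ)..1, iteratedDeriv 1 (u t) x ^ 2)
        (Icc (timeOne D K) (timeTwo σ D K)) :=
      continuousOn_const.mul (h.continuousOn_dissipation.mono hsub)
    rw [mul_assoc]
    refine le_timeAverage_rpow hT hα (by positivity) hκ0
      (A := fun t => sobolevNorm m p (u t))
      (g := fun t => (ν * (∫ x in (0 : ℝ)..1, iteratedDeriv 1 (u t) x ^ 2) - e) / K)
      ((hu.continuousOn_sobolevNorm m hp).mono hsub) (fun _ _ => sobolevNorm_nonneg _ _ _)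
      ((hGc.sub continuousOn_const).div_const _) ?_ ?_ ?_
    · intro t ht
      rw [div_le_one hK0]
      linarith [hdis t (hsub ht)]
    · rw [intervalIntegral.integral_div, intervalIntegral.integral_sub
        (hGc.intervalIntegrable_of_Icc hT.le) intervalIntegrable_const,
        intervalIntegral.integral_const, smul_eq_mul, mul_comm _ e, heΔ, hκ]
      gcongr
      linarith
    · intro t ht hpos
      have := (div_pos_iff_of_pos_right hK0).1 hpos
      exact Ha ν u h t ht.1 (by linarith)

/-- Upper estimate of the moments of the norms with `m ≤ 1` or `p > 1`. -/
lemma exists_timeAverage_le {f : ℝ → ℝ} {σ : ℝ} (hf : ContDiff ℝ ∞ f) (hσ : 0 < σ)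
    (hconv : ∀ y, σ ≤ iteratedDeriv 2 f y) {D : ℝ} (hD : 0 < D) {K : ℝ} (hK : IsEnergyConst f D K)
    (m : ℕ) {p : ℝ≥0∞} (hp : 1 ≤ p) (hmp : m ≤ 1 ∨ 1 < p) {α : ℝ} (hα : 0 < α) :
    ∃ C : ℝ, 0 < C ∧ ∀ (ν : ℝ) (u : ℝ → ℝ → ℝ), 0 < ν → ν ≤ 1 → IsSolution f ν u →
      dataSize (u 0) = D → timeAverage σ D K (fun t => sobolevNorm m p (u t) ^ α) ^ (1 / α)
        ≤ C * ν ^ (-gammaExp m p) := by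
  have hK0 := hK.1
  have hT1 := timeOne_pos hD hK0
  have hT := timeOne_lt_timeTwo (σ := σ) hD hK0
  have hsub : Icc (timeOne D K) (timeTwo σ D K) ⊆ Ici 0 := fun t ht => hT1.le.trans ht.1
  have hγ := gammaExp_nonneg m p
  obtain ⟨C, hC, H⟩ := exists_sobolevNorm_le hf σ hD m hp hmp
  refine ⟨C * max (timeOne D K ^ (-gammaExp m p)) 1, by positivity, fun ν u hν hν1 hu hDu => ?_⟩
  subst hDu
  have h := hu.admissible hf hσ hconv hν hν1
  refine timeAverage_rpow_le hT hα (by positivity)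
    ((hu.continuousOn_sobolevNorm m hp).mono hsub) (fun _ _ => sobolevNorm_nonneg _ _ _)
    (fun t ht => ?_)
  have ht0 : 0 < t := hT1.trans_le ht.1
  refine (H ν u h t ht0).trans ?_
  rw [mul_assoc]
  gcongr
  have hν1' : 1 ≤ ν ^ (-gammaExp m p) :=
    Real.one_le_rpow_of_pos_of_le_one_of_nonpos hν hν1 (by linarith)
  have ht1 : t ^ (-gammaExp m p) ≤ timeOne (dataSize (u 0)) K ^ (-gammaExp m p) :=
    Real.rpow_le_rpow_of_nonpos hT1 ht.1 (by linarith)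
  have hmax : 0 ≤ max (timeOne (dataSize (u 0)) K ^ (-gammaExp m p)) 1 :=
    zero_le_one.trans (le_max_right _ _)
  refine max_le ?_ ?_
  · calc _ ≤ max (timeOne (dataSize (u 0)) K ^ (-gammaExp m p)) 1 * 1 := by
          rw [mul_one]
          exact ht1.trans (le_max_left _ _)
      _ ≤ _ := by gcongr
  · calc _ = 1 * ν ^ (-gammaExp m p) := (one_mul _).symm
      _ ≤ _ := by
          gcongr
          exact le_max_right _ _

/-- For `D ≤ 0` there are no solutions with initial data of size `D`. -/
lemma IsSolution.dataSize_pos {f : ℝ → ℝ} {ν : ℝ} {u : ℝ → ℝ → ℝ} (hu : IsSolution f ν u) :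
    0 < dataSize (u 0) :=
  Burgulence.dataSize_pos (hu.contDiff le_rfl) (hu.periodic 0 le_rfl) hu.nontrivial

end Burgulence

theorem theorem5p9 (f : ℝ → ℝ) (σ D : ℝ) (hf : ContDiff ℝ ∞ f) (hσ : 0 < σ)
    (hconv : ∀ y, σ ≤ iteratedDeriv 2 f y) :
    -- the constant that enters the definition of the averaging interval exists
    (∃ K, Burgulence.IsEnergyConst f D K) ∧
    -- two-sided estimate of the time average
    (∀ K, Burgulence.IsEnergyConst f D K →
      ∀ (m : ℕ) (p : ℝ≥0∞) (α : ℝ), 1 ≤ p → (m ≤ 1 ∨ 1 < p) → 0 < α →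
        ∃ C : ℝ, 0 < C ∧ ∀ (ν : ℝ) (u : ℝ → ℝ → ℝ), 0 < ν → ν ≤ 1 →
          Burgulence.IsSolution f ν u → Burgulence.dataSize (u 0) = D →
          C⁻¹ * ν ^ (-Burgulence.gammaExp m p) ≤
              Burgulence.timeAverage σ D K
                (fun t => Burgulence.sobolevNorm m p (u t) ^ α) ^ (1 / α) ∧
            Burgulence.timeAverage σ D K
                (fun t => Burgulence.sobolevNorm m p (u t) ^ α) ^ (1 / α) ≤
              C * ν ^ (-Burgulence.gammaExp m p)) ∧
    -- pointwise upper estimate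
    (∀ (m : ℕ) (p : ℝ≥0∞), 1 ≤ p → (m ≤ 1 ∨ 1 < p) →
      ∃ C : ℝ, 0 < C ∧ ∀ (ν : ℝ) (u : ℝ → ℝ → ℝ), 0 < ν → ν ≤ 1 →
        Burgulence.IsSolution f ν u → Burgulence.dataSize (u 0) = D →
        ∀ t, 0 < t → Burgulence.sobolevNorm m p (u t) ≤
          C * max (t ^ (-Burgulence.gammaExp m p)) (ν ^ (-Burgulence.gammaExp m p))) ∧
    -- lower estimate of the time average, for all `m` and `p`
    (∀ K, Burgulence.IsEnergyConst f D K →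
      ∀ (m : ℕ) (p : ℝ≥0∞) (α : ℝ), 1 ≤ p → 0 < α →
        ∃ c : ℝ, 0 < c ∧ ∀ (ν : ℝ) (u : ℝ → ℝ → ℝ), 0 < ν → ν ≤ 1 →
          Burgulence.IsSolution f ν u → Burgulence.dataSize (u 0) = D →
          c * ν ^ (-Burgulence.gammaExp m p) ≤
            Burgulence.timeAverage σ D K
              (fun t => Burgulence.sobolevNorm m p (u t) ^ α) ^ (1 / α)) := by
  rcases le_or_gt D 0 with hD | hD
  · -- there are no solutions with initial data of size `D ≤ 0`
    have hno : ∀ (ν : ℝ) (u : ℝ → ℝ → ℝ), Burgulence.IsSolution f ν u →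
        Burgulence.dataSize (u 0) = D → False := fun ν u hu hDu =>
      (hDu ▸ hu.dataSize_pos).not_ge hD
    exact ⟨Burgulence.exists_isEnergyConst hf hσ hconv D,
      fun _ _ _ _ _ _ _ _ => ⟨1, one_pos, fun ν u _ _ hu hDu => (hno ν u hu hDu).elim⟩,
      fun _ _ _ _ => ⟨1, one_pos, fun ν u _ _ hu hDu => (hno ν u hu hDu).elim⟩,
      fun _ _ _ _ _ _ _ => ⟨1, one_pos, fun ν u _ _ hu hDu => (hno ν u hu hDu).elim⟩⟩
  refine ⟨Burgulence.exists_isEnergyConst hf hσ hconv D, ?_, ?_, ?_⟩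
  · intro K hK m p α hp hmp hα
    obtain ⟨c, hc, Hc⟩ := Burgulence.exists_le_timeAverage hf hσ hconv hD hK m hp hα
    obtain ⟨C, hC, HC⟩ := Burgulence.exists_timeAverage_le hf hσ hconv hD hK m hp hmp hα
    refine ⟨max C c⁻¹, lt_max_of_lt_left hC, fun ν u hν hν1 hu hDu => ⟨?_, ?_⟩⟩
    · refine le_trans ?_ (Hc ν u hν hν1 hu hDu)
      have : (max C c⁻¹)⁻¹ ≤ c := inv_le_of_inv_le₀ hc (le_max_right _ _)
      gcongr
    · refine (HC ν u hν hν1 hu hDu).trans ?_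
      gcongr
      exact le_max_left _ _
  · intro m p hp hmp
    obtain ⟨C, hC, HC⟩ := Burgulence.exists_sobolevNorm_le hf σ hD m hp hmp
    refine ⟨C, hC, fun ν u hν hν1 hu hDu t ht => ?_⟩
    subst hDu
    exact HC ν u (hu.admissible hf hσ hconv hν hν1) t ht
  · intro K hK m p α hp hα
    exact Burgulence.exists_le_timeAverage hf hσ hconv hD hK m hp hα
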